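/- Let $\mathbb C_+=\{z\in\mathbb C:\operatorname{Im}z>0\}$ and let $$W(z)=e^{Az+C+\frac{A_0}{z}}\,z^{B}\, \frac{\prod_{\nu}\bigl(1+\frac{z}{a_\nu}\bigr)^{\kappa_\nu}}{\prod_{\mu}\bigl(1-\frac{z}{b_\mu}\bigr)^{\lambda_\mu}}\cdot \frac{\prod_{\nu}\bigl(1+\frac{1}{zc_\nu}\bigr)^{\tilde\kappa_\nu}}{\prod_{\mu}\bigl(1-\frac{1}{zd_\mu}\bigr)^{\tilde\lambda_\mu}},$$ where $C\in\mathbb C$, $B\in\mathbb R$, $A,A_0\ge 0$; each of the four families of points $a_\nu,b_\mu,c_\nu,d_\mu>0$ with exponents $\kappa_\nu,\lambda_\mu,\tilde\kappa_\nu,\tilde\lambda_\mu>0$ is empty, finite, or countably infinite with points tending to $\infty$; and all products converge absolutely, i.e. $\sum\kappa_\nu/a_\nu$, $\sum\lambda_\mu/b_\mu$, $\sum\tilde\kappa_\nu/c_\nu$, $\sum\tilde\lambda_\mu/d_\mu<\infty$. The powers are principal in $\mathbb C_+$, and $W$ is extended to those points of $\mathbb R$ at which it has a finite limit from $\mathbb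 C_+$, by this limit. Assume that $W(z)\not\equiv e^Cz^B$. Let $\alpha\in\mathbb C\setminus\{0\}$, let $z_1,z_2\in\overline{\mathbb C_+}$ with $|z_1|<|z_2|$, and let $\theta>0$ be such that $W(z_1)=\alpha$ and $W(z_2)=\alpha e^{i\theta}$. Suppose that $\theta\le 2\pi$ or, more generally for larger $\theta$, that a continuous branch $\psi$ of $\log W$ in $\mathbb C_+$, extended by continuity to $z_1$ and $z_2$, satisfies $\psi(z_2)-\psi(z_1)=i\theta$. Put $C_{12}=\{z\in\overline{\mathbb C_+}:|z_1|<|z|<|z_2|\}$. Then for every $\varrho\in(0,\theta)$ there exists $z_*\in C_{12}$ such that $W(z_*)=\alpha e^{i\varrho}$, unless simultaneously $\theta\in 2\pi\mathbb Z$, both $z_1$ and $z_2$ are real, nonzero and of the same sign, and $|W(z)|\ne|\alpha|$ for all $z\in C_{12}$ at which $W$ is defined. -/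

import Mathlib

/-- The open upper half-plane `ℂ₊`, as a subset of `ℂ`. -/
def upperHalf : Set ℂ := {z : ℂ | 0 < z.im}

/-- The parameters of one absolutely convergent product `∏ (1 ± x / a_ν) ^ κ_ν`: a family (empty,
finite or countably infinite; summability of positive reals excludes anything larger) of positive
reals `a_ν` with positive real exponents `κ_ν`. The `a_ν` do not accumulate at a finite point, so
that the logarithmic derivative of the product is meromorphic in `ℂ`. -/
structure FactorFamily where
  Idx : Type
  pt : Idx → ℝ
  expo : Idx → ℝ
  pt_pos : ∀ i, 0 < pt i
  expo_pos : ∀ i, 0 < expo i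
  tendsto_pt : Filter.Tendsto pt Filter.cofinite Filter.atTop
  summable_div : Summable fun i => expo i / pt i

/-- `∏_ν (1 + x / a_ν) ^ κ_ν` with principal powers. -/
noncomputable def FactorFamily.prodAdd (F : FactorFamily) (x : ℂ) : ℂ :=
  ∏' i, (1 + x / (F.pt i : ℂ)) ^ (F.expo i : ℂ)

/-- `∏_ν (1 - x / a_ν) ^ κ_ν` with principal powers. -/
noncomputable def FactorFamily.prodSub (F : FactorFamily) (x : ℂ) : ℂ :=
  ∏' i, (1 - x / (F.pt i : ℂ)) ^ (F.expo i : ℂ)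

/-- The parameters of
`W z = e ^ (A z + C + A₀ / z) z ^ B
  * ∏ (1 + z / a_ν) ^ κ_ν / ∏ (1 - z / b_μ) ^ λ_μ
  * ∏ (1 + 1 / (z c_ν)) ^ κ'_ν / ∏ (1 - 1 / (z d_μ)) ^ λ'_μ`. -/
structure WData where
  A : ℝ
  A₀ : ℝ
  B : ℝ
  C : ℂ
  A_nonneg : 0 ≤ A
  A₀_nonneg : 0 ≤ A₀
  a : FactorFamily
  b : FactorFamily
  c : FactorFamily
  d : FactorFamily

/-- The function `W`. Only its values on `ℂ₊` are used: there `z`, `1 + z / a_ν`, `1 - z / b_μ`,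
`1 + 1 / (z c_ν)` and `1 - 1 / (z d_μ)` are not real, so all powers are holomorphic. -/
noncomputable def WData.W (D : WData) (z : ℂ) : ℂ :=
  Complex.exp ((D.A : ℂ) * z + D.C + (D.A₀ : ℂ) / z) * z ^ (D.B : ℂ)
    * (D.a.prodAdd z / D.b.prodSub z)
    * (D.c.prodAdd (1 / z) / D.d.prodSub (1 / z))

/-- `W z = w` for a point `z` of the closed upper half-plane. At a real point the value of `W` is
its continuous boundary value from `ℂ₊`; a real point without finite boundary value (a pole, or
a singularity at the origin) takes no value. -/
def WData.TakesValue (D : WData) (z w : ℂ) : Prop :=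
  (0 < z.im ∧ D.W z = w) ∨
    (z.im = 0 ∧ Filter.Tendsto D.W (nhdsWithin z upperHalf) (nhds w))

/-- The half-annulus of all `z` in the closed upper half-plane with `‖z₁‖ < ‖z‖ < ‖z₂‖`. -/
def halfAnnulus (z₁ z₂ : ℂ) : Set ℂ := {z : ℂ | 0 ≤ z.im ∧ ‖z₁‖ < ‖z‖ ∧ ‖z‖ < ‖z₂‖}

/-- Some continuous branch `ψ` of `log W` in `ℂ₊`, extended by continuity to `z₁` and `z₂`,
satisfies `ψ z₂ - ψ z₁ = i θ`. -/
def WData.LogIncrement (D : WData) (z₁ z₂ : ℂ) (θ : ℝ) : Prop :=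
  ∃ (ψ : ℂ → ℂ) (β : ℂ), ContinuousOn ψ upperHalf ∧
    (∀ z ∈ upperHalf, Complex.exp (ψ z) = D.W z) ∧
    Filter.Tendsto ψ (nhdsWithin z₁ upperHalf) (nhds β) ∧
    Filter.Tendsto ψ (nhdsWithin z₂ upperHalf) (nhds (β + (θ : ℂ) * Complex.I))

/-! Put `z = exp ζ` with `ζ = x + iy` in the strip `0 ≤ y ≤ π`, and write `log W = u + iv` there. Up
to the term `C + B ζ`, this is a sum of functions of `ζ` whose derivatives have nonnegative
imaginary part in the open strip. Hence `Im ((g q - g p) * conj (q - p)) ≥ 0` for `g = u + iv`,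
strictly so off a common edge because `W` is not `e^C z^B` (`crossForm_pos_of_deriv`,
`exists_stripPair`).

On a level set `u = L` the form reduces to `(v q - v p) (q.1 - p.1)`, so the argument of `W`
increases with `|z|`. On a vertical line `u` strictly decreases upwards, so each vertical meets the
level set at most once. The level set need not be connected, but its gaps do no harm: above a gap
`u` stays on one side of `L`, which puts both ends of the gap on one edge, with no singularity
between them. There `v` is constant (`v_eq_of_gap`). Thus `v` has the intermediate value property on
the level set (`exists_levelSet_v_eq`).

It remains to see that `v` grows by at least `θ` from `z₁` to `z₂`. The growth is nonnegative and
congruent to `θ` modulo `2π`. For `θ ≤ 2π` it can fall short only if `θ = 2π` and the growth is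
zero. Zero growth forces both points onto one edge with no level point between them
(`v_lt_of_not_sameSide`, `v_lt_of_three`), which is the excluded case. If `z₁ = 0`, the level set
runs to the left end of the strip (`exists_levelSet_left`), and a limit there replaces the starting
point. -/

open Set Filter Topology

/-! ### Strip pairs and their sums -/

/-- `(v q - v p) (q.1 - p.1) - (u q - u p) (q.2 - p.2)`: the imaginary part of
`(g q - g p) * conj (q - p)` for `g = u + i v`. -/
def crossForm (u v : ℝ × ℝ → ℝ) (p q : ℝ × ℝ) : ℝ :=
  (v q - v p) * (q.1 - p.1) - (u q - u p) * (q.2 - p.2)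

/-- Both points lie on the same boundary line of the strip `0 ≤ y ≤ π`. -/
def SameSide (p q : ℝ × ℝ) : Prop := p.2 = q.2 ∧ (p.2 = 0 ∨ p.2 = Real.pi)

/-- Real and imaginary part of a function `g` in the closed strip `0 ≤ y ≤ π` whose derivative
maps the open strip into the closed upper half-plane (into the open one if `N`). The set `R`
consists of the open strip and the regular boundary points; at the remaining boundary points
`u` tends to `-∞` on the upper side and to `+∞` on the lower one. -/
structure StripPair (N : Prop) (R : Set (ℝ × ℝ)) (u v : ℝ × ℝ → ℝ) : Prop where
  snd_nonneg : ∀ p ∈ R, 0 ≤ p.2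
  snd_le : ∀ p ∈ R, p.2 ≤ Real.pi
  interior_mem : ∀ p : ℝ × ℝ, 0 < p.2 → p.2 < Real.pi → p ∈ R
  cont_u : ContinuousOn u R
  cont_v : ContinuousOn v R
  nonneg : ∀ p ∈ R, ∀ q ∈ R, 0 ≤ crossForm u v p q
  pos : N → ∀ p ∈ R, ∀ q ∈ R, p ≠ q → ¬ SameSide p q → 0 < crossForm u v p q
  tendsto_lower : ∀ x, (x, 0) ∉ R → Tendsto u (𝓝[R] (x, 0)) atTop
  tendsto_upper : ∀ x, (x, Real.pi) ∉ R → Tendsto u (𝓝[R] (x, Real.pi)) atBot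
  v_lower : ∀ s t, s ≤ t → (∀ x ∈ Icc s t, (x, (0 : ℝ)) ∈ R) → v (s, 0) = v (t, 0)
  v_upper : ∀ s t, s ≤ t → (∀ x ∈ Icc s t, (x, Real.pi) ∈ R) → v (s, Real.pi) = v (t, Real.pi)
  convex : ∀ m d, 0 < d → (∀ x ∈ Icc (m - d) (m + d), (x, (0 : ℝ)) ∈ R) →
    2 * u (m, 0) ≤ u (m - d, 0) + u (m + d, 0)
  strict_convex : N → ∀ m d, 0 < d → (∀ x ∈ Icc (m - d) (m + d), (x, (0 : ℝ)) ∈ R) →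
    2 * u (m, 0) < u (m - d, 0) + u (m + d, 0)
  concave : ∀ m d, 0 < d → (∀ x ∈ Icc (m - d) (m + d), (x, Real.pi) ∈ R) →
    u (m - d, Real.pi) + u (m + d, Real.pi) ≤ 2 * u (m, Real.pi)
  strict_concave : N → ∀ m d, 0 < d → (∀ x ∈ Icc (m - d) (m + d), (x, Real.pi) ∈ R) →
    u (m - d, Real.pi) + u (m + d, Real.pi) < 2 * u (m, Real.pi)

namespace StripPair

variable {N N₁ N₂ : Prop} {R R₁ R₂ : Set (ℝ × ℝ)} {u v u₁ v₁ u₂ v₂ : ℝ × ℝ → ℝ}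

theorem congr_nontrivial (h : StripPair N R u v) (hN : N₁ → N) : StripPair N₁ R u v :=
  { h with
    pos := fun n => h.pos (hN n)
    strict_convex := fun n => h.strict_convex (hN n)
    strict_concave := fun n => h.strict_concave (hN n) }

/-- Every condition is additive. At a singular boundary point no cancellation can occur, since the
sign of the blow-up depends only on the edge. -/
theorem add (h₁ : StripPair N₁ R₁ u₁ v₁) (h₂ : StripPair N₂ R₂ u₂ v₂) :
    StripPair (N₁ ∨ N₂) (R₁ ∩ R₂) (fun p => u₁ p + u₂ p) (fun p => v₁ p + v₂ p) where
  snd_nonneg p hp := h₁.snd_nonneg p hp.1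
  snd_le p hp := h₁.snd_le p hp.1
  interior_mem p h h' := ⟨h₁.interior_mem p h h', h₂.interior_mem p h h'⟩
  cont_u := (h₁.cont_u.mono inter_subset_left).add (h₂.cont_u.mono inter_subset_right)
  cont_v := (h₁.cont_v.mono inter_subset_left).add (h₂.cont_v.mono inter_subset_right)
  nonneg p hp q hq := by
    have := h₁.nonneg p hp.1 q hq.1
    have := h₂.nonneg p hp.2 q hq.2
    unfold crossForm at *; linarith
  pos n p hp q hq hpq hs := by
    have a₁ := h₁.nonneg p hp.1 q hq.1
    have a₂ := h₂.nonneg p hp.2 q hq.2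
    rcases n with n | n
    · have := h₁.pos n p hp.1 q hq.1 hpq hs
      unfold crossForm at *; linarith
    · have := h₂.pos n p hp.2 q hq.2 hpq hs
      unfold crossForm at *; linarith
  tendsto_lower x hx := by
    have e₁ : 𝓝[R₁ ∩ R₂] (x, (0 : ℝ)) ≤ 𝓝[R₁] (x, 0) := nhdsWithin_mono _ inter_subset_left
    have e₂ : 𝓝[R₁ ∩ R₂] (x, (0 : ℝ)) ≤ 𝓝[R₂] (x, 0) := nhdsWithin_mono _ inter_subset_right
    by_cases m₁ : (x, (0 : ℝ)) ∈ R₁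
    · have m₂ : (x, (0 : ℝ)) ∉ R₂ := fun m₂ => hx ⟨m₁, m₂⟩
      exact ((h₁.cont_u _ m₁).mono_left e₁).add_atTop ((h₂.tendsto_lower x m₂).mono_left e₂)
    · by_cases m₂ : (x, (0 : ℝ)) ∈ R₂
      · exact ((h₁.tendsto_lower x m₁).mono_left e₁).atTop_add ((h₂.cont_u _ m₂).mono_left e₂)
      · exact Tendsto.atTop_add_atTop ((h₁.tendsto_lower x m₁).mono_left e₁)
          ((h₂.tendsto_lower x m₂).mono_left e₂)
  tendsto_upper x hx := by
    have e₁ : 𝓝[R₁ ∩ R₂] (x, Real.pi) ≤ 𝓝[R₁] (x, Real.pi) := nhdsWithin_mono _ inter_subset_left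
    have e₂ : 𝓝[R₁ ∩ R₂] (x, Real.pi) ≤ 𝓝[R₂] (x, Real.pi) := nhdsWithin_mono _ inter_subset_right
    by_cases m₁ : (x, Real.pi) ∈ R₁
    · have m₂ : (x, Real.pi) ∉ R₂ := fun m₂ => hx ⟨m₁, m₂⟩
      exact ((h₁.cont_u _ m₁).mono_left e₁).add_atBot ((h₂.tendsto_upper x m₂).mono_left e₂)
    · by_cases m₂ : (x, Real.pi) ∈ R₂
      · exact ((h₁.tendsto_upper x m₁).mono_left e₁).atBot_add ((h₂.cont_u _ m₂).mono_left e₂)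
      · exact Tendsto.atBot_add_atBot ((h₁.tendsto_upper x m₁).mono_left e₁)
          ((h₂.tendsto_upper x m₂).mono_left e₂)
  v_lower s t hst hx := by
    rw [h₁.v_lower s t hst fun x m => (hx x m).1, h₂.v_lower s t hst fun x m => (hx x m).2]
  v_upper s t hst hx := by
    rw [h₁.v_upper s t hst fun x m => (hx x m).1, h₂.v_upper s t hst fun x m => (hx x m).2]
  convex m d hd hx := by
    have := h₁.convex m d hd fun x m => (hx x m).1
    have := h₂.convex m d hd fun x m => (hx x m).2
    linarith
  strict_convex n m d hd hx := by
    have a₁ := h₁.convex m d hd fun x m => (hx x m).1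
    have a₂ := h₂.convex m d hd fun x m => (hx x m).2
    rcases n with n | n
    · have := h₁.strict_convex n m d hd fun x m => (hx x m).1
      linarith
    · have := h₂.strict_convex n m d hd fun x m => (hx x m).2
      linarith
  concave m d hd hx := by
    have := h₁.concave m d hd fun x m => (hx x m).1
    have := h₂.concave m d hd fun x m => (hx x m).2
    linarith
  strict_concave n m d hd hx := by
    have a₁ := h₁.concave m d hd fun x m => (hx x m).1
    have a₂ := h₂.concave m d hd fun x m => (hx x m).2
    rcases n with n | n
    · have := h₁.strict_concave n m d hd fun x m => (hx x m).1
      linarith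
    · have := h₂.strict_concave n m d hd fun x m => (hx x m).2
      linarith

end StripPair

/-! ### Reflections of the strip -/

/-- Reflection of the strip in its middle line. -/
noncomputable def flipY (p : ℝ × ℝ) : ℝ × ℝ := (p.1, Real.pi - p.2)

/-- Reflection of the strip in the vertical axis. -/
def flipX (p : ℝ × ℝ) : ℝ × ℝ := (-p.1, p.2)

theorem continuous_flipY : Continuous flipY := by unfold flipY; fun_prop

theorem continuous_flipX : Continuous flipX := by unfold flipX; fun_prop

theorem flipY_flipY (p : ℝ × ℝ) : flipY (flipY p) = p := by simp [flipY]

theorem flipX_flipX (p : ℝ × ℝ) : flipX (flipX p) = p := by simp [flipX]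

theorem Continuous.tendsto_nhdsWithin_preimage {X Y : Type*} [TopologicalSpace X]
    [TopologicalSpace Y] {f : X → Y} (hf : Continuous f) (R : Set Y) (x : X) :
    Tendsto f (𝓝[f ⁻¹' R] x) (𝓝[R] (f x)) :=
  hf.continuousWithinAt.tendsto_nhdsWithin fun _ h => h

namespace StripPair

variable {N N₁ N₂ : Prop} {R R₁ R₂ : Set (ℝ × ℝ)} {u v u₁ v₁ u₂ v₂ : ℝ × ℝ → ℝ}

/-- This is `ζ ↦ -conj (g (conj ζ + iπ))`. It exchanges the edges, and convexity with concavity, so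
that statements about one edge give those about the other; it also produces the factors in `-z`. -/
theorem reflectY (h : StripPair N R u v) :
    StripPair N (flipY ⁻¹' R) (fun p => -u (flipY p)) (fun p => v (flipY p)) where
  snd_nonneg p hp := by have := h.snd_le _ hp; simp only [flipY] at this; linarith
  snd_le p hp := by have := h.snd_nonneg _ hp; simp only [flipY] at this; linarith
  interior_mem p a b := h.interior_mem _ (by simp only [flipY]; linarith)
    (by simp only [flipY]; linarith)
  cont_u := (h.cont_u.comp continuous_flipY.continuousOn fun _ m => m).neg
  cont_v := h.cont_v.comp continuous_flipY.continuousOn fun _ m => m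
  nonneg p hp q hq := by
    have := h.nonneg _ hp _ hq
    unfold crossForm at *; simp only [flipY] at *; linarith
  pos n p hp q hq hpq hs := by
    have := h.pos n _ hp _ hq (fun e => hpq (by rw [← flipY_flipY p, e, flipY_flipY])) (by
      rintro ⟨e, e'⟩
      simp only [flipY] at e e'
      refine hs ⟨by linarith, ?_⟩
      rcases e' with e' | e'
      · right; linarith
      · left; linarith)
    unfold crossForm at *; simp only [flipY] at *; linarith
  tendsto_lower x hx := by
    have e : flipY (x, 0) = (x, Real.pi) := by simp [flipY]
    rw [mem_preimage, e] at hx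
    have := continuous_flipY.tendsto_nhdsWithin_preimage R (x, 0)
    rw [e] at this
    exact tendsto_neg_atBot_atTop.comp ((h.tendsto_upper x hx).comp this)
  tendsto_upper x hx := by
    have e : flipY (x, Real.pi) = (x, 0) := by simp [flipY]
    rw [mem_preimage, e] at hx
    have := continuous_flipY.tendsto_nhdsWithin_preimage R (x, Real.pi)
    rw [e] at this
    exact tendsto_neg_atTop_atBot.comp ((h.tendsto_lower x hx).comp this)
  v_lower s t hst hx := by
    simp only [mem_preimage, flipY, sub_zero] at *
    exact h.v_upper s t hst hx
  v_upper s t hst hx := by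
    simp only [mem_preimage, flipY, sub_self] at *
    exact h.v_lower s t hst hx
  convex m d hd hx := by
    simp only [mem_preimage, flipY, sub_zero] at *
    have := h.concave m d hd hx; linarith
  strict_convex n m d hd hx := by
    simp only [mem_preimage, flipY, sub_zero] at *
    have := h.strict_concave n m d hd hx; linarith
  concave m d hd hx := by
    simp only [mem_preimage, flipY, sub_self] at *
    have := h.convex m d hd hx; linarith
  strict_concave n m d hd hx := by
    simp only [mem_preimage, flipY, sub_self] at *
    have := h.strict_convex n m d hd hx; linarith

/-- This is `ζ ↦ conj (g (-conj ζ))`, which produces the factors in `1 / z`. -/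
theorem reflectX (h : StripPair N R u v) :
    StripPair N (flipX ⁻¹' R) (fun p => u (flipX p)) (fun p => -v (flipX p)) where
  snd_nonneg p hp := h.snd_nonneg (flipX p) hp
  snd_le p hp := h.snd_le (flipX p) hp
  interior_mem p a b := h.interior_mem _ a b
  cont_u := h.cont_u.comp continuous_flipX.continuousOn fun _ m => m
  cont_v := (h.cont_v.comp continuous_flipX.continuousOn fun _ m => m).neg
  nonneg p hp q hq := by
    have := h.nonneg _ hp _ hq
    unfold crossForm at *; simp only [flipX] at *; linarith
  pos n p hp q hq hpq hs := by
    have := h.pos n _ hp _ hq (fun e => hpq (by rw [← flipX_flipX p, e, flipX_flipX])) hs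
    unfold crossForm at *; simp only [flipX] at *; linarith
  tendsto_lower x hx :=
    (h.tendsto_lower (-x) hx).comp (continuous_flipX.tendsto_nhdsWithin_preimage R (x, 0))
  tendsto_upper x hx :=
    (h.tendsto_upper (-x) hx).comp (continuous_flipX.tendsto_nhdsWithin_preimage R (x, Real.pi))
  v_lower s t hst hx := by
    simp only [mem_preimage, flipX] at *
    rw [h.v_lower (-t) (-s) (by linarith) fun x m => by
      simpa using hx (-x) ⟨by linarith [m.2], by linarith [m.1]⟩]
  v_upper s t hst hx := by
    simp only [mem_preimage, flipX] at *
    rw [h.v_upper (-t) (-s) (by linarith) fun x m => by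
      simpa using hx (-x) ⟨by linarith [m.2], by linarith [m.1]⟩]
  convex m d hd hx := by
    simp only [mem_preimage, flipX] at *
    have := h.convex (-m) d hd fun x m => by
      simpa using hx (-x) ⟨by linarith [m.2], by linarith [m.1]⟩
    rw [show -(m - d) = -m + d by ring, show -(m + d) = -m - d by ring]; linarith
  strict_convex n m d hd hx := by
    simp only [mem_preimage, flipX] at *
    have := h.strict_convex n (-m) d hd fun x m => by
      simpa using hx (-x) ⟨by linarith [m.2], by linarith [m.1]⟩
    rw [show -(m - d) = -m + d by ring, show -(m + d) = -m - d by ring]; linarith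
  concave m d hd hx := by
    simp only [mem_preimage, flipX] at *
    have := h.concave (-m) d hd fun x m => by
      simpa using hx (-x) ⟨by linarith [m.2], by linarith [m.1]⟩
    rw [show -(m - d) = -m + d by ring, show -(m + d) = -m - d by ring]; linarith
  strict_concave n m d hd hx := by
    simp only [mem_preimage, flipX] at *
    have := h.strict_concave n (-m) d hd fun x m => by
      simpa using hx (-x) ⟨by linarith [m.2], by linarith [m.1]⟩
    rw [show -(m - d) = -m + d by ring, show -(m + d) = -m - d by ring]; linarith

end StripPair

/-! ### The argument along a level set -/

/-- The regular points at which `u = L`. -/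
def levelSet (R : Set (ℝ × ℝ)) (u : ℝ × ℝ → ℝ) (L : ℝ) : Set (ℝ × ℝ) := {p | p ∈ R ∧ u p = L}

namespace StripPair

variable {N : Prop} {R : Set (ℝ × ℝ)} {u v : ℝ × ℝ → ℝ} {L : ℝ}

theorem mem_levelSet_reflectY {p : ℝ × ℝ} :
    flipY p ∈ levelSet (flipY ⁻¹' R) (fun p => -u (flipY p)) (-L) ↔ p ∈ levelSet R u L := by
  simp [levelSet, flipY_flipY]

theorem mem_levelSet_reflectY' {p : ℝ × ℝ} :
    p ∈ levelSet (flipY ⁻¹' R) (fun p => -u (flipY p)) (-L) ↔ flipY p ∈ levelSet R u L := by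
  simp [levelSet]

/-- Since `u` blows up at the singular boundary points, level points cannot accumulate there;
elsewhere `u` is continuous. -/
theorem isClosed_levelSet (h : StripPair N R u v) : IsClosed (levelSet R u L) := by
  have hsub : levelSet R u L ⊆ R := fun _ m => m.1
  refine isClosed_of_closure_subset fun p hp => ?_
  have hne : (𝓝[levelSet R u L] p).NeBot := mem_closure_iff_nhdsWithin_neBot.1 hp
  have hc : Tendsto u (𝓝[levelSet R u L] p) (𝓝 L) :=
    tendsto_const_nhds.congr' (eventually_nhdsWithin_of_forall fun q hq => hq.2.symm)
  have hstrip : p ∈ {p : ℝ × ℝ | 0 ≤ p.2 ∧ p.2 ≤ Real.pi} := by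
    refine closure_minimal (s := levelSet R u L)
      (fun q hq => And.intro (h.snd_nonneg q hq.1) (h.snd_le q hq.1)) ?_ hp
    exact (isClosed_le continuous_const continuous_snd).inter
      (isClosed_le continuous_snd continuous_const)
  by_cases hR : p ∈ R
  · exact ⟨hR, tendsto_nhds_unique ((h.cont_u p hR).mono_left (nhdsWithin_mono _ hsub)) hc⟩
  exfalso
  obtain ⟨x, y⟩ := p
  rcases hstrip.1.eq_or_lt with h0 | h0
  · simp only at h0; subst h0
    exact not_tendsto_nhds_of_tendsto_atTop
      ((h.tendsto_lower x hR).mono_left (nhdsWithin_mono _ hsub)) _ hc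
  · rcases hstrip.2.eq_or_lt with h1 | h1
    · simp only at h1; subst h1
      exact not_tendsto_nhds_of_tendsto_atBot
        ((h.tendsto_upper x hR).mono_left (nhdsWithin_mono _ hsub)) _ hc
    · exact hR (h.interior_mem _ h0 h1)

theorem mem_closure_box {s t x y : ℝ} (hst : s < t) (hx : x ∈ Icc s t) (hy : 0 ≤ y)
    (hy' : y ≤ Real.pi) : (x, y) ∈ closure (Ioo s t ×ˢ Ioo 0 Real.pi) := by
  rw [closure_prod_eq, closure_Ioo hst.ne, closure_Ioo Real.pi_pos.ne]
  exact ⟨hx, hy, hy'⟩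

theorem box_subset (h : StripPair N R u v) (s t : ℝ) : Ioo s t ×ˢ Ioo 0 Real.pi ⊆ R :=
  fun p hp => h.interior_mem p hp.2.1 hp.2.2

/-- A closed condition on the values in the open strip passes to the regular boundary points. -/
theorem mem_of_box (h : StripPair N R u v) {f : ℝ × ℝ → ℝ} (hf : ContinuousOn f R) {C : Set ℝ}
    (hC : IsClosed C) {s t : ℝ} (hst : s < t) (hbox : ∀ q ∈ Ioo s t ×ˢ Ioo 0 Real.pi, f q ∈ C)
    {p : ℝ × ℝ} (hp : p ∈ R) (hx : p.1 ∈ Icc s t) : f p ∈ C := by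
  have hcl := mem_closure_box hst hx (h.snd_nonneg p hp) (h.snd_le p hp)
  have hne : (𝓝[Ioo s t ×ˢ Ioo 0 Real.pi] p).NeBot := mem_closure_iff_nhdsWithin_neBot.1 hcl
  exact hC.mem_of_tendsto ((hf p hp).mono_left (nhdsWithin_mono _ (h.box_subset s t)))
    (eventually_nhdsWithin_of_forall hbox)

/-- On a vertical line `crossForm` says that `u` strictly decreases upwards. A level point below the
upper edge would have points with `u < L` above it. -/
theorem snd_eq_of_box_lt (h : StripPair True R u v) {s t : ℝ} (hst : s < t)
    (hbox : ∀ q ∈ Ioo s t ×ˢ Ioo 0 Real.pi, L < u q) {p : ℝ × ℝ} (hp : p ∈ levelSet R u L)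
    (hx : p.1 ∈ Icc s t) : p.2 = Real.pi := by
  by_contra hne
  have hlt : p.2 < Real.pi := lt_of_le_of_ne (h.snd_le p hp.1) hne
  obtain ⟨y, hy, hy'⟩ := exists_between hlt
  have h0 := h.snd_nonneg p hp.1
  have hq : (p.1, y) ∈ R := h.interior_mem _ (h0.trans_lt hy) hy'
  have h1 : L ≤ u (p.1, y) :=
    h.mem_of_box h.cont_u isClosed_Ici hst (fun q m => (hbox q m).le) hq hx
  have h2 := h.pos trivial p hp.1 _ hq (fun e => hy.ne (congrArg Prod.snd e)) fun e => hy.ne e.1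
  simp only [crossForm, sub_self, mul_zero, zero_sub, hp.2] at h2
  nlinarith

/-- A singular point of the upper edge would force `u` to `-∞` inside the box. -/
theorem upper_mem_of_box_lt (h : StripPair N R u v) {s t : ℝ} (hst : s < t)
    (hbox : ∀ q ∈ Ioo s t ×ˢ Ioo 0 Real.pi, L < u q) {x : ℝ} (hx : x ∈ Icc s t) :
    (x, Real.pi) ∈ R := by
  by_contra hR
  have hcl := mem_closure_box hst hx Real.pi_pos.le le_rfl
  have hne : (𝓝[Ioo s t ×ˢ Ioo 0 Real.pi] (x, Real.pi)).NeBot :=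
    mem_closure_iff_nhdsWithin_neBot.1 hcl
  have h1 := ((h.tendsto_upper x hR).mono_left (nhdsWithin_mono _ (h.box_subset s t))).eventually
    (eventually_lt_atBot L)
  obtain ⟨q, hq, hq'⟩ := (h1.and self_mem_nhdsWithin).exists
  exact (hbox q hq').not_gt hq

theorem box_lt_or_gt (h : StripPair N R u v) {s t : ℝ}
    (hbox : ∀ q ∈ Ioo s t ×ˢ Ioo 0 Real.pi, u q ≠ L) :
    (∀ q ∈ Ioo s t ×ˢ Ioo 0 Real.pi, L < u q) ∨ ∀ q ∈ Ioo s t ×ˢ Ioo 0 Real.pi, u q < L := by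
  have hpre : IsPreconnected (Ioo s t ×ˢ Ioo 0 Real.pi) := isPreconnected_Ioo.prod isPreconnected_Ioo
  by_contra! hcon
  obtain ⟨⟨q, hq, hqL⟩, r, hr, hrL⟩ := hcon
  obtain ⟨w, hw, hwL⟩ := hpre.intermediate_value hq hr (h.cont_u.mono (h.box_subset s t))
    ⟨hqL, hrL⟩
  exact hbox w hw hwL

theorem flipY_mem_box {s t : ℝ} {q : ℝ × ℝ} (hq : q ∈ Ioo s t ×ˢ Ioo 0 Real.pi) :
    flipY q ∈ Ioo s t ×ˢ Ioo 0 Real.pi :=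
  ⟨hq.1, by simp only [flipY]; linarith [hq.2.2], by simp only [flipY]; linarith [hq.2.1]⟩

/-- Between two consecutive points of the level set, the boundary is regular on the side
on which both points lie. -/
theorem gap (h : StripPair True R u v) {p q : ℝ × ℝ} (hp : p ∈ levelSet R u L)
    (hq : q ∈ levelSet R u L) (hpq : p.1 < q.1)
    (hgap : ∀ r ∈ levelSet R u L, ¬ (p.1 < r.1 ∧ r.1 < q.1)) :
    (p.2 = Real.pi ∧ q.2 = Real.pi ∧ ∀ x ∈ Icc p.1 q.1, (x, Real.pi) ∈ R) ∨
      (p.2 = 0 ∧ q.2 = 0 ∧ ∀ x ∈ Icc p.1 q.1, (x, (0 : ℝ)) ∈ R) := by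
  have hbox : ∀ r ∈ Ioo p.1 q.1 ×ˢ Ioo 0 Real.pi, u r ≠ L := fun r hr e =>
    hgap r ⟨h.box_subset _ _ hr, e⟩ hr.1
  rcases h.box_lt_or_gt hbox with hb | hb
  · exact Or.inl ⟨h.snd_eq_of_box_lt hpq hb hp ⟨le_rfl, hpq.le⟩,
      h.snd_eq_of_box_lt hpq hb hq ⟨hpq.le, le_rfl⟩, fun x hx => h.upper_mem_of_box_lt hpq hb hx⟩
  -- The case `u < L` is the case `u > L` for the pair reflected in the middle line.
  · have hb' : ∀ r ∈ Ioo p.1 q.1 ×ˢ Ioo 0 Real.pi, -L < -u (flipY r) := fun r hr =>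
      neg_lt_neg (hb _ (flipY_mem_box hr))
    have a₁ := h.reflectY.snd_eq_of_box_lt hpq hb' (mem_levelSet_reflectY.2 hp) ⟨le_rfl, hpq.le⟩
    have a₂ := h.reflectY.snd_eq_of_box_lt hpq hb' (mem_levelSet_reflectY.2 hq) ⟨hpq.le, le_rfl⟩
    simp only [flipY] at a₁ a₂
    refine Or.inr ⟨by linarith, by linarith, fun x hx => ?_⟩
    simpa [flipY] using h.reflectY.upper_mem_of_box_lt hpq hb' hx

/-- The argument is constant along a regular edge interval, so it does not jump across a gap. This
takes the place of connectedness of the level set. -/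
theorem v_eq_of_gap (h : StripPair True R u v) {p q : ℝ × ℝ} (hp : p ∈ levelSet R u L)
    (hq : q ∈ levelSet R u L) (hpq : p.1 < q.1)
    (hgap : ∀ r ∈ levelSet R u L, ¬ (p.1 < r.1 ∧ r.1 < q.1)) : v p = v q := by
  obtain ⟨p₁, p₂⟩ := p
  obtain ⟨q₁, q₂⟩ := q
  rcases h.gap hp hq hpq hgap with ⟨e, e', hx⟩ | ⟨e, e', hx⟩
  · simp only at e e' hx; subst e e'
    exact h.v_upper _ _ hpq.le hx
  · simp only at e e' hx; subst e e'
    exact h.v_lower _ _ hpq.le hx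

theorem v_le_of_levelSet (h : StripPair N R u v) {p q : ℝ × ℝ} (hp : p ∈ levelSet R u L)
    (hq : q ∈ levelSet R u L) (hpq : p.1 < q.1) : v p ≤ v q := by
  have := h.nonneg p hp.1 q hq.1
  simp only [crossForm, hp.2, hq.2, sub_self, zero_mul, sub_zero] at this
  nlinarith

/-- By strict monotonicity of `u` on verticals, the level set is a graph over its projection to the
`x`-axis. -/
theorem eq_of_fst_eq (h : StripPair True R u v) {p q : ℝ × ℝ} (hp : p ∈ levelSet R u L)
    (hq : q ∈ levelSet R u L) (hpq : p.1 = q.1) : p = q := by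
  by_contra hne
  have := h.pos trivial p hp.1 q hq.1 hne fun e => hne (Prod.ext hpq e.1)
  simp [crossForm, hp.2, hq.2, hpq] at this

theorem isCompact_levelSet_inter (h : StripPair N R u v) (s t : ℝ) :
    IsCompact (levelSet R u L ∩ {p | p.1 ∈ Icc s t}) := by
  have : levelSet R u L ∩ {p | p.1 ∈ Icc s t} = (Icc s t ×ˢ Icc 0 Real.pi) ∩ levelSet R u L := by
    ext p
    constructor
    · rintro ⟨a, b⟩; exact ⟨⟨b, h.snd_nonneg p a.1, h.snd_le p a.1⟩, a⟩
    · rintro ⟨a, b⟩; exact ⟨b, a.1⟩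
  rw [this]
  exact (isCompact_Icc.prod isCompact_Icc).inter_right h.isClosed_levelSet

/-- The argument takes all intermediate values on the level set. -/
theorem exists_levelSet_v_eq (h : StripPair True R u v) {p q : ℝ × ℝ} (hp : p ∈ levelSet R u L)
    (hq : q ∈ levelSet R u L) (hpq : p.1 < q.1) {c : ℝ} (hpc : v p < c) (hcq : c < v q) :
    ∃ r ∈ levelSet R u L, p.1 < r.1 ∧ r.1 < q.1 ∧ v r = c := by
  have hK := h.isCompact_levelSet_inter (L := L) p.1 q.1
  set K := levelSet R u L ∩ {r | r.1 ∈ Icc p.1 q.1} with hKdef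
  have hvK : ContinuousOn v K := h.cont_v.mono fun r hr => hr.1.1
  have hlo : IsCompact (K ∩ v ⁻¹' Iic c) :=
    hK.of_isClosed_subset (hvK.preimage_isClosed_of_isClosed hK.isClosed isClosed_Iic)
      inter_subset_left
  have hhi : IsCompact (K ∩ v ⁻¹' Ici c) :=
    hK.of_isClosed_subset (hvK.preimage_isClosed_of_isClosed hK.isClosed isClosed_Ici)
      inter_subset_left
  -- The rightmost level point with `v ≤ c` and the leftmost one with `v ≥ c`. If `c` were omitted
  -- they would bound a gap, or else contradict the monotonicity of `v`.
  obtain ⟨r, hr, hrmax⟩ := hlo.exists_isMaxOn ⟨p, ⟨hp, le_rfl, hpq.le⟩, hpc.le⟩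
    continuous_fst.continuousOn
  obtain ⟨w, hw, hwmin⟩ := hhi.exists_isMinOn ⟨q, ⟨hq, hpq.le, le_rfl⟩, hcq.le⟩
    continuous_fst.continuousOn
  have key : ∀ r ∈ K, v r = c → ∃ r ∈ levelSet R u L, p.1 < r.1 ∧ r.1 < q.1 ∧ v r = c := by
    rintro r ⟨hr, hx, hx'⟩ e
    refine ⟨r, hr, lt_of_le_of_ne hx fun e' => ?_, lt_of_le_of_ne hx' fun e' => ?_, e⟩
    · rw [h.eq_of_fst_eq hp hr e'] at hpc; exact hpc.ne e
    · rw [← h.eq_of_fst_eq hr hq e'] at hcq; exact hcq.ne e.symm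
  by_contra hcon
  have hrc : v r < c := lt_of_le_of_ne hr.2 fun e => hcon (key r hr.1 e)
  have hwc : c < v w := lt_of_le_of_ne hw.2 fun e => hcon (key w hw.1 e.symm)
  rcases lt_trichotomy r.1 w.1 with hlt | heq | hgt
  · have := h.v_eq_of_gap hr.1.1 hw.1.1 hlt fun s hs hsx => by
      have hsK : s ∈ K := ⟨hs, hr.1.2.1.trans hsx.1.le, hsx.2.le.trans hw.1.2.2⟩
      rcases le_total (v s) c with hsc | hsc
      · exact (hrmax (a := s) ⟨hsK, hsc⟩).not_gt hsx.1
      · exact (hwmin (a := s) ⟨hsK, hsc⟩).not_gt hsx.2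
    linarith
  · rw [h.eq_of_fst_eq hr.1.1 hw.1.1 heq] at hrc; linarith
  · have := h.v_le_of_levelSet hw.1.1 hr.1.1 hgt
    linarith

theorem v_lt_of_not_sameSide (h : StripPair True R u v) {p q : ℝ × ℝ} (hp : p ∈ levelSet R u L)
    (hq : q ∈ levelSet R u L) (hpq : p.1 < q.1) (hs : ¬ SameSide p q) : v p < v q := by
  have := h.pos trivial p hp.1 q hq.1 (fun e => hpq.ne (congrArg Prod.fst e)) hs
  simp only [crossForm, hp.2, hq.2, sub_self, zero_mul, sub_zero] at this
  nlinarith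

/-- Equal outer arguments would keep the whole level set in between on the upper edge. A singular
point there would lie in a gap, whose edge is regular; so `u` is strictly midpoint concave on the
interval and cannot take the value `L` three times. -/
theorem v_ne_of_three_upper (h : StripPair True R u v) {x₁ x₂ x₃ : ℝ} (h₁₂ : x₁ < x₂)
    (h₂₃ : x₂ < x₃) (h₁ : (x₁, Real.pi) ∈ levelSet R u L) (h₂ : (x₂, Real.pi) ∈ levelSet R u L)
    (h₃ : (x₃, Real.pi) ∈ levelSet R u L) : v (x₁, Real.pi) ≠ v (x₃, Real.pi) := by
  intro hv
  have side : ∀ q ∈ levelSet R u L, q.1 ∈ Icc x₁ x₃ → q.2 = Real.pi := by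
    intro q hq hx
    rcases hx.1.eq_or_lt with e | e
    · rw [← h.eq_of_fst_eq h₁ hq e]
    rcases hx.2.eq_or_lt with e' | e'
    · rw [h.eq_of_fst_eq hq h₃ e']
    by_contra hne
    have := h.v_lt_of_not_sameSide h₁ hq e fun s => hne s.1.symm
    have := h.v_lt_of_not_sameSide hq h₃ e' fun s => hne s.1
    linarith
  have reg : ∀ x ∈ Icc x₁ x₃, (x, Real.pi) ∈ R := by
    intro x hx
    by_contra hxR
    obtain ⟨p, hp, hpmax⟩ := (h.isCompact_levelSet_inter (L := L) x₁ x).exists_isMaxOn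
      ⟨_, h₁, le_rfl, hx.1⟩ continuous_fst.continuousOn
    obtain ⟨q, hq, hqmin⟩ := (h.isCompact_levelSet_inter (L := L) x x₃).exists_isMinOn
      ⟨_, h₃, hx.2, le_rfl⟩ continuous_fst.continuousOn
    have hp2 := side p hp.1 ⟨hp.2.1, hp.2.2.trans hx.2⟩
    have hq2 := side q hq.1 ⟨hx.1.trans hq.2.1, hq.2.2⟩
    have hpx : p.1 < x := lt_of_le_of_ne hp.2.2 fun e => hxR (by
      rw [← e, ← hp2]; exact hp.1.1)
    have hxq : x < q.1 := lt_of_le_of_ne hq.2.1 fun e => hxR (by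
      rw [e, ← hq2]; exact hq.1.1)
    rcases h.gap hp.1 hq.1 (hpx.trans hxq) (fun r hr hrx => by
      rcases le_total r.1 x with hle | hle
      · exact (hpmax (a := r) ⟨hr, hp.2.1.trans hrx.1.le, hle⟩).not_gt hrx.1
      · exact (hqmin (a := r) ⟨hr, hle, hrx.2.le.trans hq.2.2⟩).not_gt hrx.2) with g | g
    · exact hxR (g.2.2 x ⟨hpx.le, hxq.le⟩)
    · exact Real.pi_pos.ne' (hp2.symm.trans g.1)
  have hcont : ContinuousOn (fun x : ℝ => u (x, Real.pi)) (Icc x₁ x₃) :=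
    h.cont_u.comp (by fun_prop) reg
  obtain ⟨m, hm, hmin⟩ := isCompact_Icc.exists_isMinOn ⟨x₁, le_rfl, (h₁₂.trans h₂₃).le⟩ hcont
  -- A minimum at an end point has the value `L`, which is also attained at the interior point `x₂`.
  obtain ⟨m, hm, hmin⟩ : ∃ m ∈ Ioo x₁ x₃, ∀ x ∈ Icc x₁ x₃, u (m, Real.pi) ≤ u (x, Real.pi) := by
    by_cases hmo : m ∈ Ioo x₁ x₃
    · exact ⟨m, hmo, hmin⟩
    · refine ⟨x₂, ⟨h₁₂, h₂₃⟩, fun x hx => (le_of_eq ?_).trans (hmin hx)⟩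
      rcases hm.1.eq_or_lt with e | e
      · simp only; rw [← e, h₁.2, h₂.2]
      · rcases hm.2.eq_or_lt with e' | e'
        · simp only; rw [e', h₃.2, h₂.2]
        · exact absurd ⟨e, e'⟩ hmo
  have hd : 0 < min (m - x₁) (x₃ - m) := lt_min (by linarith [hm.1]) (by linarith [hm.2])
  have d₁ := min_le_left (m - x₁) (x₃ - m)
  have d₂ := min_le_right (m - x₁) (x₃ - m)
  set d := min (m - x₁) (x₃ - m)
  have := h.strict_concave trivial m d hd fun x hx =>
    reg x ⟨by linarith [hx.1], by linarith [hx.2]⟩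
  have := hmin (m - d) ⟨by linarith, by linarith⟩
  have := hmin (m + d) ⟨by linarith, by linarith⟩
  linarith

/-- Along three points of the level set the argument strictly increases. -/
theorem v_lt_of_three (h : StripPair True R u v) {p₁ p₂ p₃ : ℝ × ℝ} (h₁ : p₁ ∈ levelSet R u L)
    (h₂ : p₂ ∈ levelSet R u L) (h₃ : p₃ ∈ levelSet R u L) (h₁₂ : p₁.1 < p₂.1)
    (h₂₃ : p₂.1 < p₃.1) : v p₁ < v p₃ := by
  have a := h.v_le_of_levelSet h₁ h₂ h₁₂
  have b := h.v_le_of_levelSet h₂ h₃ h₂₃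
  by_contra hcon
  have s₁ : SameSide p₁ p₂ := by
    by_contra hs; have := h.v_lt_of_not_sameSide h₁ h₂ h₁₂ hs; linarith
  have s₂ : SameSide p₂ p₃ := by
    by_contra hs; have := h.v_lt_of_not_sameSide h₂ h₃ h₂₃ hs; linarith
  have hv : v p₁ = v p₃ := by linarith
  rcases s₁ with ⟨e, e'⟩
  have f := s₂.1
  obtain ⟨x₁, y₁⟩ := p₁
  obtain ⟨x₂, y₂⟩ := p₂
  obtain ⟨x₃, y₃⟩ := p₃
  simp only at e e' f h₁₂ h₂₃
  subst e f
  rcases e' with e' | e' <;> subst e'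
  · refine h.reflectY.v_ne_of_three_upper (L := -L) h₁₂ h₂₃ ?_ ?_ ?_ ?_
    · rw [mem_levelSet_reflectY']; simpa [flipY] using h₁
    · rw [mem_levelSet_reflectY']; simpa [flipY] using h₂
    · rw [mem_levelSet_reflectY']; simpa [flipY] using h₃
    · simpa [flipY] using hv
  · exact h.v_ne_of_three_upper h₁₂ h₂₃ h₁ h₂ h₃ hv

/-! ### The level set near the left end of the strip -/

/-- If `u` tends to `L` at the left end of the strip, then `u` is not greater than `L` there. -/
theorem not_lt_left (h : StripPair True R u v)
    (hlim : ∀ ε > 0, ∃ X, ∀ p : ℝ × ℝ, p.1 < X → 0 < p.2 → p.2 < Real.pi → |u p - L| ≤ ε)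
    {X : ℝ} (hX : ∀ p : ℝ × ℝ, p.1 < X → 0 < p.2 → p.2 < Real.pi → L < u p) : False := by
  have reg : ∀ x < X, (x, Real.pi) ∈ R := fun x hx =>
    h.upper_mem_of_box_lt hx (fun q hq => hX q hq.1.2 hq.2.1 hq.2.2) ⟨le_rfl, hx.le⟩
  have hge : ∀ x < X, L ≤ u (x, Real.pi) := fun x hx =>
    h.mem_of_box h.cont_u isClosed_Ici hx (fun q hq => (hX q hq.1.2 hq.2.1 hq.2.2).le) (reg x hx)
      ⟨le_rfl, hx.le⟩
  -- Samples of `u` on the upper edge at unit steps to the left. By strict concavity the differences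
  -- `a n - a (n + 1)` strictly increase, and they tend to `0`, so they are nonpositive. Hence `a 0
  -- < a 1 ≤ L`, against `L ≤ a 0`.
  set a : ℕ → ℝ := fun n => u (X - 1 - n, Real.pi) with ha
  have hmem : ∀ n : ℕ, X - 1 - (n : ℝ) < X := fun n => by
    have : (0 : ℝ) ≤ n := n.cast_nonneg
    linarith
  have hlim_a : Tendsto a atTop (𝓝 L) := by
    rw [Metric.tendsto_atTop]
    intro ε hε
    obtain ⟨Y, hY⟩ := hlim (ε / 2) (half_pos hε)
    obtain ⟨n₀, hn₀⟩ := exists_nat_gt (X - Y)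
    refine ⟨n₀, fun n hn => ?_⟩
    have hn' : (n₀ : ℝ) ≤ n := by exact_mod_cast hn
    have hxY : X - 1 - (n : ℝ) < Y := by linarith
    have hC : IsClosed {w : ℝ | |w - L| ≤ ε / 2} :=
      isClosed_le (by fun_prop) continuous_const
    have : |a n - L| ≤ ε / 2 := h.mem_of_box h.cont_u hC hxY
      (fun q hq => hY q hq.1.2 hq.2.1 hq.2.2) (reg _ (hmem n)) ⟨le_rfl, hxY.le⟩
    rw [Real.dist_eq]
    linarith
  have hconc : ∀ n, a n - a (n + 1) < a (n + 1) - a (n + 2) := by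
    intro n
    have hn : (0 : ℝ) ≤ n := n.cast_nonneg
    have := h.strict_concave trivial (X - 1 - (n + 1 : ℕ)) 1 one_pos fun x hx =>
      reg x (by have := hx.2; push_cast at this; linarith)
    have e₁ : X - 1 - ((n + 1 : ℕ) : ℝ) - 1 = X - 1 - ((n + 2 : ℕ) : ℝ) := by push_cast; ring
    have e₂ : X - 1 - ((n + 1 : ℕ) : ℝ) + 1 = X - 1 - (n : ℝ) := by push_cast; ring
    rw [e₁, e₂] at this
    simp only [ha]
    linarith
  have hdiff : Tendsto (fun n => a n - a (n + 1)) atTop (𝓝 0) := by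
    simpa using hlim_a.sub (hlim_a.comp (tendsto_add_atTop_nat 1))
  have hnonpos : ∀ n, a n - a (n + 1) ≤ 0 := fun n =>
    (monotone_nat_of_le_succ fun n => (hconc n).le).ge_of_tendsto hdiff n
  have hmono : Monotone a := monotone_nat_of_le_succ fun n => by linarith [hnonpos n]
  have h1 := hmono.ge_of_tendsto hlim_a 1
  have h2 := hconc 0
  have h3 := hnonpos 1
  have h4 : L ≤ a 0 := hge _ (hmem 0)
  simp only [zero_add] at *
  norm_num at h3
  linarith

/-- If `u` tends to `L` at the left end of the strip, then the level set extends to that end. -/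
theorem exists_levelSet_left (h : StripPair True R u v)
    (hlim : ∀ ε > 0, ∃ X, ∀ p : ℝ × ℝ, p.1 < X → 0 < p.2 → p.2 < Real.pi → |u p - L| ≤ ε)
    (X : ℝ) : ∃ p ∈ levelSet R u L, p.1 < X := by
  by_contra! hcon
  have hne : ∀ p : ℝ × ℝ, p.1 < X → 0 < p.2 → p.2 < Real.pi → u p ≠ L := fun p hx h₀ h₁ e =>
    (hcon p ⟨h.interior_mem p h₀ h₁, e⟩).not_gt hx
  have hpre : IsPreconnected (Iio X ×ˢ Ioo 0 Real.pi) := isPreconnected_Iio.prod isPreconnected_Ioo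
  have hcont : ContinuousOn u (Iio X ×ˢ Ioo 0 Real.pi) :=
    h.cont_u.mono fun p hp => h.interior_mem p hp.2.1 hp.2.2
  -- If `L` is not attained, connectedness puts `u` on one side of `L` in the whole half-strip; the
  -- side `u < L` is treated by reflection.
  by_cases hex : ∃ p : ℝ × ℝ, p ∈ Iio X ×ˢ Ioo 0 Real.pi ∧ u p < L
  · obtain ⟨p, hp, hpL⟩ := hex
    refine h.reflectY.not_lt_left (L := -L) (X := X) (fun ε hε => ?_) fun q hx h₀ h₁ => ?_
    · obtain ⟨Y, hY⟩ := hlim ε hε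
      refine ⟨Y, fun q hx h₀ h₁ => ?_⟩
      have := hY (flipY q) hx (by simp only [flipY]; linarith) (by simp only [flipY]; linarith)
      rwa [neg_sub_neg, abs_sub_comm]
    · by_contra hq
      have hq' : flipY q ∈ Iio X ×ˢ Ioo 0 Real.pi :=
        ⟨hx, by simp only [flipY]; linarith, by simp only [flipY]; linarith⟩
      obtain ⟨w, hw, hwL⟩ := hpre.intermediate_value hp hq' hcont ⟨hpL.le, by linarith⟩
      exact hne w hw.1 hw.2.1 hw.2.2 hwL
  · push Not at hex
    exact h.not_lt_left hlim fun q hx h₀ h₁ =>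
      lt_of_le_of_ne (hex q ⟨hx, h₀, h₁⟩) (hne q hx h₀ h₁).symm

end StripPair

/-! ### Elementary strip pairs -/

/-- A point of the plane as a complex number. -/
def toC (p : ℝ × ℝ) : ℂ := ⟨p.1, p.2⟩

theorem continuous_toC : Continuous toC :=
  Complex.equivRealProdCLM.symm.continuous

def closedStrip : Set (ℝ × ℝ) := {p | 0 ≤ p.2 ∧ p.2 ≤ Real.pi}

/-- Along the segment, `Im (f * conj (q - p))` has derivative `Im f' * |q - p| ^ 2`. -/
theorem crossForm_pos_of_deriv {f : ℂ → ℂ} {p q : ℝ × ℝ} (hpq : p ≠ q)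
    (hc : ContinuousOn f (segment ℝ (toC p) (toC q)))
    (hd : ∀ z ∈ openSegment ℝ (toC p) (toC q), ∃ f', HasDerivAt f f' z ∧ 0 < f'.im) :
    0 < crossForm (fun p => (f (toC p)).re) (fun p => (f (toC p)).im) p q := by
  set l : ℝ → ℂ := fun t => toC p + t * (toC q - toC p) with hl
  set k : ℝ → ℝ := fun t => (f (l t)).im * (q.1 - p.1) - (f (l t)).re * (q.2 - p.2) with hk
  have hlc : Continuous l := by fun_prop
  have hlm : ∀ t ∈ Icc (0 : ℝ) 1, l t ∈ segment ℝ (toC p) (toC q) := fun t ht => by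
    rw [segment_eq_image']; exact ⟨t, ht, by simp [hl]⟩
  have hlo : ∀ t ∈ Ioo (0 : ℝ) 1, l t ∈ openSegment ℝ (toC p) (toC q) := fun t ht => by
    rw [openSegment_eq_image']; exact ⟨t, ht, by simp [hl]⟩
  have hfl : ContinuousOn (fun t => f (l t)) (Icc 0 1) := hc.comp hlc.continuousOn hlm
  have hkc : ContinuousOn k (Icc 0 1) :=
    ((Complex.continuous_im.comp_continuousOn hfl).mul continuousOn_const).sub
      ((Complex.continuous_re.comp_continuousOn hfl).mul continuousOn_const)
  have hmono : StrictMonoOn k (Icc 0 1) := by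
    refine strictMonoOn_of_deriv_pos (convex_Icc 0 1) hkc fun t ht => ?_
    rw [interior_Icc] at ht
    obtain ⟨f', hf', him⟩ := hd _ (hlo t ht)
    have hld : HasDerivAt l (toC q - toC p) t := by
      have := ((Complex.ofRealCLM.hasDerivAt (x := t)).mul_const (toC q - toC p)).const_add (toC p)
      rwa [Complex.ofRealCLM_apply, Complex.ofReal_one, one_mul] at this
    have hfd : HasDerivAt (fun t => f (l t)) (f' * (toC q - toC p)) t :=
      hf'.comp_of_eq t hld rfl
    have hre : HasDerivAt (fun t => (f (l t)).re) (f' * (toC q - toC p)).re t :=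
      Complex.reCLM.hasFDerivAt.comp_hasDerivAt t hfd
    have him' : HasDerivAt (fun t => (f (l t)).im) (f' * (toC q - toC p)).im t :=
      Complex.imCLM.hasFDerivAt.comp_hasDerivAt t hfd
    have hkd := (him'.mul_const (q.1 - p.1)).sub (hre.mul_const (q.2 - p.2))
    have : deriv k t = f'.im * ((q.1 - p.1) ^ 2 + (q.2 - p.2) ^ 2) := by
      refine hkd.deriv.trans ?_
      simp only [Complex.mul_im, Complex.mul_re, Complex.sub_re, Complex.sub_im, toC]
      ring
    rw [this]
    refine mul_pos him ?_
    by_cases h1 : q.1 = p.1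
    · have h2 : q.2 - p.2 ≠ 0 := fun e => hpq (Prod.ext h1.symm (by linarith))
      positivity
    · have h2 : q.1 - p.1 ≠ 0 := sub_ne_zero.2 h1
      positivity
  have := hmono (left_mem_Icc.2 zero_le_one) (right_mem_Icc.2 zero_le_one) zero_lt_one
  simp only [hk, hl, Complex.ofReal_zero, zero_mul, add_zero, Complex.ofReal_one, one_mul,
    add_sub_cancel] at this
  unfold crossForm
  linarith

theorem im_mem_of_openSegment {p q : ℝ × ℝ} (hp : p ∈ closedStrip) (hq : q ∈ closedStrip)
    (hs : ¬ SameSide p q) {z : ℂ} (hz : z ∈ openSegment ℝ (toC p) (toC q)) :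
    0 < z.im ∧ z.im < Real.pi := by
  obtain ⟨a, b, ha, hb, hab, rfl⟩ := hz
  simp only [Complex.add_im, Complex.real_smul, Complex.mul_im, Complex.ofReal_re,
    Complex.ofReal_im, zero_mul, add_zero, toC]
  obtain ⟨p1, p2⟩ := hp
  obtain ⟨q1, q2⟩ := hq
  constructor
  · rcases p1.eq_or_lt with e | e
    · rcases q1.eq_or_lt with e' | e'
      · exact absurd ⟨e.symm.trans e', Or.inl e.symm⟩ hs
      · positivity
    · positivity
  · have hb' : b = 1 - a := by linarith
    subst hb'
    rcases p2.eq_or_lt with e | e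
    · rcases q2.eq_or_lt with e' | e'
      · exact absurd ⟨e.trans e'.symm, Or.inr e⟩ hs
      · rw [e]; nlinarith
    · nlinarith

/-- A real slope makes `crossForm` vanish identically. This is why `B` may have either sign, and why
this term contributes no strictness. -/
theorem stripPair_linear (B c d : ℝ) :
    StripPair False closedStrip (fun p => c + B * p.1) (fun p => d + B * p.2) where
  snd_nonneg p hp := hp.1
  snd_le p hp := hp.2
  interior_mem p h h' := ⟨h.le, h'.le⟩
  cont_u := by fun_prop
  cont_v := by fun_prop
  nonneg p _ q _ := by simp only [crossForm]; exact le_of_eq (by ring)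
  pos n := n.elim
  tendsto_lower x hx := absurd ⟨le_rfl, Real.pi_pos.le⟩ hx
  tendsto_upper x hx := absurd ⟨Real.pi_pos.le, le_rfl⟩ hx
  v_lower _ _ _ _ := rfl
  v_upper _ _ _ _ := rfl
  convex m d hd _ := le_of_eq (by ring)
  strict_convex n := n.elim
  concave m d hd _ := le_of_eq (by ring)
  strict_concave n := n.elim

theorem Complex.exp_im_pos {z : ℂ} (h : 0 < z.im ∧ z.im < Real.pi) : 0 < (Complex.exp z).im := by
  rw [Complex.exp_im]
  exact mul_pos (Real.exp_pos _) (Real.sin_pos_of_pos_of_lt_pi h.1 h.2)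

theorem Complex.exp_im_nonneg {z : ℂ} (h : 0 ≤ z.im ∧ z.im ≤ Real.pi) :
    0 ≤ (Complex.exp z).im := by
  rw [Complex.exp_im]
  exact mul_nonneg (Real.exp_pos _).le (Real.sin_nonneg_of_nonneg_of_le_pi h.1 h.2)

theorem two_mul_exp_lt (m d : ℝ) (hd : 0 < d) :
    2 * Real.exp m < Real.exp (m - d) + Real.exp (m + d) := by
  have h1 : Real.exp (m - d) * Real.exp d = Real.exp m := by rw [← Real.exp_add]; ring_nf
  have h2 : Real.exp m * Real.exp d = Real.exp (m + d) := by rw [← Real.exp_add]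
  have h3 : 1 < Real.exp d := Real.one_lt_exp_iff.2 hd
  nlinarith [Real.exp_pos (m - d), mul_pos (Real.exp_pos (m - d)) (pow_pos (sub_pos.2 h3) 2)]

theorem stripPair_exp {A : ℝ} (hA : 0 ≤ A) :
    StripPair (0 < A) closedStrip (fun p => A * (Real.exp p.1 * Real.cos p.2))
      (fun p => A * (Real.exp p.1 * Real.sin p.2)) where
  snd_nonneg p hp := hp.1
  snd_le p hp := hp.2
  interior_mem p h h' := ⟨h.le, h'.le⟩
  cont_u := by fun_prop
  cont_v := by fun_prop
  nonneg p hp q hq := by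
    by_cases hpq : p = q
    · subst hpq; simp [crossForm]
    by_cases hs : SameSide p q
    · obtain ⟨e, e'⟩ := hs
      rcases e' with e' | e' <;> simp [crossForm, ← e, e']
    · have := crossForm_pos_of_deriv hpq Complex.continuous_exp.continuousOn fun z hz =>
        ⟨_, Complex.hasDerivAt_exp z, Complex.exp_im_pos (im_mem_of_openSegment hp hq hs hz)⟩
      simp only [crossForm, Complex.exp_re, Complex.exp_im, toC] at *
      nlinarith
  pos n p hp q hq hpq hs := by
    have := crossForm_pos_of_deriv hpq Complex.continuous_exp.continuousOn fun z hz =>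
        ⟨_, Complex.hasDerivAt_exp z, Complex.exp_im_pos (im_mem_of_openSegment hp hq hs hz)⟩
    simp only [crossForm, Complex.exp_re, Complex.exp_im, toC] at *
    nlinarith
  tendsto_lower x hx := absurd ⟨le_rfl, Real.pi_pos.le⟩ hx
  tendsto_upper x hx := absurd ⟨Real.pi_pos.le, le_rfl⟩ hx
  v_lower _ _ _ _ := by simp
  v_upper _ _ _ _ := by simp
  convex m d hd _ := by
    have := two_mul_exp_lt m d hd
    simp only [Real.cos_zero, mul_one]; nlinarith
  strict_convex n m d hd _ := by
    have := two_mul_exp_lt m d hd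
    simp only [Real.cos_zero, mul_one]; nlinarith
  concave m d hd _ := by
    have := two_mul_exp_lt m d hd
    simp only [Real.cos_pi, mul_neg, mul_one]; nlinarith
  strict_concave n m d hd _ := by
    have := two_mul_exp_lt m d hd
    simp only [Real.cos_pi, mul_neg, mul_one]; nlinarith

theorem continuousWithinAt_log_of_im_nonneg {w : ℂ} (hw : w ≠ 0) :
    ContinuousWithinAt Complex.log {z | 0 ≤ z.im} w := by
  by_cases h : w ∈ Complex.slitPlane
  · exact (continuousAt_clog h).continuousWithinAt
  · rw [Complex.mem_slitPlane_iff] at h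
    push Not at h
    refine Complex.continuousWithinAt_log_of_re_neg_of_im_zero (lt_of_le_of_ne h.1 fun e => hw ?_)
      h.2
    exact Complex.ext e h.2

/-! ### The logarithm of a single factor -/

/-- The factor `1 + z / a` at `z = exp (x + i y)`. -/
noncomputable def linFactor (a : ℝ) (p : ℝ × ℝ) : ℂ := 1 + Complex.exp (toC p) / a

/-- The regular points of `log (1 + z / a)`. -/
def logRegular (a : ℝ) : Set (ℝ × ℝ) :=
  {p | p ∈ closedStrip ∧ ¬ (p.2 = Real.pi ∧ Real.exp p.1 = a)}

section LogTerm

variable {a : ℝ}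

theorem linFactor_im (p : ℝ × ℝ) : (linFactor a p).im = Real.exp p.1 * Real.sin p.2 / a := by
  simp [linFactor, toC, Complex.exp_im]

theorem linFactor_re (p : ℝ × ℝ) : (linFactor a p).re = 1 + Real.exp p.1 * Real.cos p.2 / a := by
  simp [linFactor, toC, Complex.exp_re]

theorem linFactor_lower (x : ℝ) : linFactor a (x, 0) = ((1 + Real.exp x / a : ℝ) : ℂ) := by
  apply Complex.ext <;> simp only [linFactor_im, linFactor_re, Complex.ofReal_re, Complex.ofReal_im]
    <;> simp

theorem linFactor_upper (x : ℝ) : linFactor a (x, Real.pi) = ((1 - Real.exp x / a : ℝ) : ℂ) := by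
  apply Complex.ext <;> simp only [linFactor_im, linFactor_re, Complex.ofReal_re, Complex.ofReal_im]
    <;> simp
  ring

theorem linFactor_ne_zero (ha : 0 < a) {p : ℝ × ℝ} (hp : p ∈ logRegular a) :
    linFactor a p ≠ 0 := by
  intro h
  have him : (linFactor a p).im = 0 := by rw [h]; rfl
  have hre : (linFactor a p).re = 0 := by rw [h]; rfl
  have hpi := Real.pi_pos
  obtain ⟨x, y⟩ := p
  obtain ⟨⟨h0, h1⟩, h2⟩ := hp
  rcases h0.eq_or_lt with e | e
  · simp only at e; subst e
    rw [linFactor_re] at hre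
    simp only [Real.cos_zero, mul_one] at hre
    have : 0 < Real.exp x / a := by positivity
    linarith
  · rcases h1.eq_or_lt with e' | e'
    · simp only at e'; subst e'
      rw [linFactor_re] at hre
      simp only [Real.cos_pi] at hre
      refine h2 ⟨rfl, ?_⟩
      field_simp at hre
      simp only; linarith
    · rw [linFactor_im] at him
      have := Real.sin_pos_of_pos_of_lt_pi e e'
      have : 0 < Real.exp x * Real.sin y / a := by positivity
      simp only at him; linarith

theorem linFactor_im_nonneg (ha : 0 < a) {p : ℝ × ℝ} (hp : p ∈ closedStrip) :
    0 ≤ (linFactor a p).im := by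
  rw [linFactor_im]
  have := Real.sin_nonneg_of_nonneg_of_le_pi hp.1 hp.2
  positivity

theorem continuous_linFactor : Continuous (linFactor a) := by
  have := continuous_toC
  unfold linFactor; fun_prop

theorem continuousOn_log_linFactor (ha : 0 < a) :
    ContinuousOn (fun p => Complex.log (linFactor a p)) (logRegular a) := fun _ hp =>
  (continuousWithinAt_log_of_im_nonneg (linFactor_ne_zero ha hp)).comp
    continuous_linFactor.continuousWithinAt fun _ hq => linFactor_im_nonneg ha hq.1

theorem norm_linFactor_lower (ha : 0 < a) (x : ℝ) : ‖linFactor a (x, 0)‖ = 1 + Real.exp x / a := by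
  rw [linFactor_lower, Complex.norm_real, Real.norm_of_nonneg (by positivity)]

theorem arg_linFactor_lower (ha : 0 < a) (x : ℝ) : (linFactor a (x, 0)).arg = 0 := by
  rw [linFactor_lower, Complex.arg_ofReal_of_nonneg (by positivity)]

theorem arg_linFactor_upper (ha : 0 < a) (x : ℝ) :
    (linFactor a (x, Real.pi)).arg = if Real.exp x ≤ a then 0 else Real.pi := by
  rw [linFactor_upper]
  split_ifs with h
  · exact Complex.arg_ofReal_of_nonneg (by rw [sub_nonneg, div_le_one ha]; exact h)
  · exact Complex.arg_ofReal_of_neg (by rw [sub_neg, one_lt_div ha]; exact not_le.1 h)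

theorem logRegular_upper_Icc (ha : 0 < a) {s t : ℝ}
    (h : ∀ x ∈ Icc s t, (x, Real.pi) ∈ logRegular a) : Real.exp t < a ∨ a < Real.exp s := by
  by_contra! hcon
  refine (h (Real.log a) ⟨?_, ?_⟩).2 ⟨rfl, Real.exp_log ha⟩
  · rw [Real.le_log_iff_exp_le ha]; exact hcon.2
  · rw [Real.log_le_iff_le_exp ha]; exact hcon.1

/-- With `w = exp ζ / a` the derivative is `w / (1 + w)`, whose imaginary part is `Im w / |1 + w| ^
2`. -/
theorem crossForm_log_pos (ha : 0 < a) {p q : ℝ × ℝ} (hp : p ∈ logRegular a)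
    (hq : q ∈ logRegular a) (hpq : p ≠ q) (hs : ¬ SameSide p q) :
    0 < crossForm (fun p => (Complex.log (linFactor a p)).re)
      (fun p => (Complex.log (linFactor a p)).im) p q := by
  refine crossForm_pos_of_deriv (f := fun z => Complex.log (1 + Complex.exp z / a)) hpq ?_ ?_
  · have hseg : segment ℝ (toC p) (toC q) ⊆ toC '' logRegular a := by
      rw [← insert_endpoints_openSegment]
      rintro z (rfl | rfl | hz)
      · exact ⟨p, hp, rfl⟩
      · exact ⟨q, hq, rfl⟩
      · have := im_mem_of_openSegment hp.1 hq.1 hs hz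
        exact ⟨(z.re, z.im), ⟨⟨this.1.le, this.2.le⟩, fun e => this.2.ne e.1⟩, rfl⟩
    have hcont : Continuous fun z : ℂ => ((z.re, z.im) : ℝ × ℝ) := by fun_prop
    refine ((continuousOn_log_linFactor ha).comp hcont.continuousOn ?_).congr fun z _ => rfl
    intro z hz
    obtain ⟨r, hr, rfl⟩ := hseg hz
    exact hr
  · intro z hz
    have hz' := Complex.exp_im_pos (im_mem_of_openSegment hp.1 hq.1 hs hz)
    have him : (1 + Complex.exp z / a).im = (Complex.exp z).im / a := by simp
    have him' : 0 < (1 + Complex.exp z / a).im := by rw [him]; positivity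
    have hd : HasDerivAt (fun z : ℂ => 1 + Complex.exp z / a) (Complex.exp z / a) z :=
      ((Complex.hasDerivAt_exp z).div_const _).const_add 1
    refine ⟨_, hd.clog (Complex.mem_slitPlane_iff.2 (Or.inr him'.ne')), ?_⟩
    set w := Complex.exp z / (a : ℂ)
    have hw : 0 < w.im := by simpa using him'
    have hn : 0 < Complex.normSq (1 + w) := Complex.normSq_pos.2 fun e => by
      rw [e] at him'; simp at him'
    have : (w / (1 + w)).im = w.im / Complex.normSq (1 + w) := by
      rw [Complex.div_im]; simp; ring
    rw [this]
    positivity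

/-- Since `exp (m - d) * exp (m + d) = exp m ^ 2`, the quadratic terms cancel, and both inequalities
reduce to `two_mul_exp_lt`. -/
theorem linFactor_mul_lt (ha : 0 < a) (m d : ℝ) (hd : 0 < d) :
    (1 - Real.exp (m - d) / a) * (1 - Real.exp (m + d) / a) < (1 - Real.exp m / a) ^ 2 ∧
    (1 + Real.exp m / a) ^ 2 < (1 + Real.exp (m - d) / a) * (1 + Real.exp (m + d) / a) := by
  have h0 := two_mul_exp_lt m d hd
  have h1 : 2 * (Real.exp m / a) < Real.exp (m - d) / a + Real.exp (m + d) / a := by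
    rw [← add_div, ← mul_div_assoc]; gcongr
  have h2 : (Real.exp (m - d) / a) * (Real.exp (m + d) / a) = (Real.exp m / a) ^ 2 := by
    rw [div_mul_div_comm, ← Real.exp_add, div_pow, ← Real.exp_nat_mul]
    congr 1
    · congr 1; push_cast; ring
    · ring
  constructor <;> nlinarith

theorem log_linFactor_upper_concave (ha : 0 < a) (m d : ℝ) (hd : 0 < d)
    (h : ∀ x ∈ Icc (m - d) (m + d), (x, Real.pi) ∈ logRegular a) :
    Real.log ‖linFactor a (m - d, Real.pi)‖ + Real.log ‖linFactor a (m + d, Real.pi)‖ <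
      2 * Real.log ‖linFactor a (m, Real.pi)‖ := by
  have hm : ∀ x ∈ Icc (m - d) (m + d), linFactor a (x, Real.pi) ≠ 0 := fun x hx =>
    linFactor_ne_zero ha (h x hx)
  have h₁ := hm (m - d) ⟨le_rfl, by linarith⟩
  have h₂ := hm (m + d) ⟨by linarith, le_rfl⟩
  have h₃ := hm m ⟨by linarith, by linarith⟩
  rw [← Real.log_mul (norm_ne_zero_iff.2 h₁) (norm_ne_zero_iff.2 h₂), ← norm_mul,
    show (2 : ℝ) = ((2 : ℕ) : ℝ) by norm_num, ← Real.log_pow, ← norm_pow]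
  refine Real.log_lt_log (norm_pos_iff.2 (mul_ne_zero h₁ h₂)) ?_
  rw [linFactor_upper, linFactor_upper, linFactor_upper, ← Complex.ofReal_mul,
    ← Complex.ofReal_pow, Complex.norm_real, Complex.norm_real, Real.norm_eq_abs, Real.norm_eq_abs,
    abs_of_nonneg (sq_nonneg (1 - Real.exp m / a)), abs_of_nonneg]
  · exact (linFactor_mul_lt ha m d hd).1
  -- The interval avoids `log a`, so the two outer factors have the same sign.
  · have hmono : Real.exp (m - d) ≤ Real.exp (m + d) := Real.exp_le_exp.2 (by linarith)
    rcases logRegular_upper_Icc ha h with h4 | h4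
    · refine mul_nonneg ?_ ?_ <;> rw [sub_nonneg, div_le_one ha] <;> linarith
    · refine mul_nonneg_of_nonpos_of_nonpos ?_ ?_ <;> rw [sub_nonpos, one_le_div ha] <;> linarith

theorem log_linFactor_lower_convex (ha : 0 < a) (m d : ℝ) (hd : 0 < d) :
    2 * Real.log ‖linFactor a (m, 0)‖ <
      Real.log ‖linFactor a (m - d, 0)‖ + Real.log ‖linFactor a (m + d, 0)‖ := by
  simp only [norm_linFactor_lower ha]
  rw [← Real.log_mul (by positivity) (by positivity),
    show (2 : ℝ) = ((2 : ℕ) : ℝ) by norm_num, ← Real.log_pow]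
  exact Real.log_lt_log (by positivity) (linFactor_mul_lt ha m d hd).2

theorem stripPair_log (ha : 0 < a) {k : ℝ} (hk : 0 < k) :
    StripPair True (logRegular a) (fun p => k * Real.log ‖linFactor a p‖)
      (fun p => k * (linFactor a p).arg) := by
  have hpos : ∀ p ∈ logRegular a, ∀ q ∈ logRegular a, p ≠ q → ¬ SameSide p q →
      0 < crossForm (fun p => k * Real.log ‖linFactor a p‖) (fun p => k * (linFactor a p).arg)
        p q := fun p hp q hq hpq hs => by
    have := crossForm_log_pos ha hp hq hpq hs
    simp only [crossForm, Complex.log_re, Complex.log_im] at *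
    nlinarith
  exact {
    snd_nonneg := fun p hp => hp.1.1
    snd_le := fun p hp => hp.1.2
    interior_mem := fun p h h' => ⟨⟨h.le, h'.le⟩, fun e => h'.ne e.1⟩
    cont_u := continuousOn_const.mul (by
      simpa only [Complex.log_re, Function.comp_def] using
        Complex.continuous_re.comp_continuousOn (continuousOn_log_linFactor ha))
    cont_v := continuousOn_const.mul (by
      simpa only [Complex.log_im, Function.comp_def] using
        Complex.continuous_im.comp_continuousOn (continuousOn_log_linFactor ha))
    nonneg := fun p hp q hq => by
      by_cases hpq : p = q
      · subst hpq; simp [crossForm]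
      by_cases hs : SameSide p q
      · obtain ⟨x, y⟩ := p
        obtain ⟨x', y'⟩ := q
        obtain ⟨e, e'⟩ := hs
        simp only at e e'
        subst e
        simp only [crossForm, sub_self, mul_zero, sub_zero]
        rcases e' with e' | e' <;> subst e'
        · simp [arg_linFactor_lower ha]
        -- On the upper edge the argument jumps from `0` to `π` as `x` passes `log a`, hence is
        -- nondecreasing across the singularity.
        · have hpi := Real.pi_pos
          rw [arg_linFactor_upper ha, arg_linFactor_upper ha]
          rcases le_total x x' with hx | hx
          · have := Real.exp_le_exp.2 hx
            refine mul_nonneg ?_ (by linarith)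
            split_ifs <;> first | linarith | nlinarith
          · have := Real.exp_le_exp.2 hx
            refine mul_nonneg_of_nonpos_of_nonpos ?_ (by linarith)
            split_ifs <;> first | linarith | nlinarith
      · exact (hpos p hp q hq hpq hs).le
    pos := fun _ => hpos
    tendsto_lower := fun x hx =>
      absurd ⟨⟨le_rfl, Real.pi_pos.le⟩, fun e => Real.pi_pos.ne e.1⟩ hx
    tendsto_upper := fun x hx => by
      have hx' : Real.exp x = a := by
        by_contra hne
        exact hx ⟨⟨Real.pi_pos.le, le_rfl⟩, fun e => hne e.2⟩
      have hz : linFactor a (x, Real.pi) = 0 := by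
        rw [linFactor_upper, hx', div_self ha.ne']; simp
      have ht : Tendsto (fun p => ‖linFactor a p‖) (𝓝[logRegular a] (x, Real.pi)) (𝓝[≠] 0) := by
        refine tendsto_nhdsWithin_iff.2 ⟨?_, eventually_nhdsWithin_of_forall fun p hp =>
          norm_ne_zero_iff.2 (linFactor_ne_zero ha hp)⟩
        have := (continuous_linFactor (a := a)).norm.tendsto (x, Real.pi)
        rw [hz, norm_zero] at this
        exact this.mono_left nhdsWithin_le_nhds
      exact (Real.tendsto_log_nhdsNE_zero.comp ht).const_mul_atBot hk
    v_lower := fun s t _ _ => by simp [arg_linFactor_lower ha]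
    v_upper := fun s t hst h => by
      have hmono : Real.exp s ≤ Real.exp t := Real.exp_le_exp.2 hst
      simp only [arg_linFactor_upper ha]
      rcases logRegular_upper_Icc ha h with h | h
      · rw [if_pos (by linarith), if_pos h.le]
      · rw [if_neg (by linarith), if_neg (by linarith)]
    convex := fun m d hd _ => by
      have := log_linFactor_lower_convex ha m d hd
      nlinarith
    strict_convex := fun _ m d hd _ => by
      have := log_linFactor_lower_convex ha m d hd
      nlinarith
    concave := fun m d hd h => by
      have := log_linFactor_upper_concave ha m d hd h
      nlinarith
    strict_concave := fun _ m d hd h => by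
      have := log_linFactor_upper_concave ha m d hd h
      nlinarith }

end LogTerm

/-! ### Infinite sums of strip pairs -/

theorem summable_and_tsum_eq_of_bound {ι : Type*} [DecidableEq ι] {f b : ι → ℝ} (T : Finset ι)
    (hb : Summable b) (h : ∀ i ∉ T, |f i| ≤ b i) :
    Summable f ∧ ∑' i, f i = ∑ i ∈ T, f i + ∑' i, if i ∈ T then 0 else f i := by
  have h1 : Summable fun i => if i ∈ T then 0 else f i := by
    refine Summable.of_norm_bounded hb.abs fun i => ?_
    split_ifs with hi
    · simp
    · exact (h i hi).trans (le_abs_self _)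
  have h2 : HasSum (fun i => if i ∈ T then f i else 0) (∑ i ∈ T, f i) := by
    have : HasSum (fun i => if i ∈ T then f i else 0) (∑ i ∈ T, if i ∈ T then f i else 0) :=
      hasSum_sum_of_ne_finset_zero fun i hi => if_neg hi
    rwa [Finset.sum_congr rfl fun i hi => if_pos hi] at this
  have h3 : HasSum f (∑ i ∈ T, f i + ∑' i, if i ∈ T then 0 else f i) := by
    convert h2.add h1.hasSum using 2 with i
    split_ifs <;> simp
  exact ⟨h3.summable, h3.tsum_eq⟩

namespace StripPair

variable {ι : Type*} {R : ι → Set (ℝ × ℝ)} {u v : ι → ℝ × ℝ → ℝ}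

/-- Serves only for the blow-up at singular points, so strictness is dropped. The factor
`closedStrip` covers the empty sum. -/
theorem finsetSum [DecidableEq ι] {N : Prop} (h : ∀ i, StripPair N (R i) (u i) (v i))
    (T : Finset ι) :
    StripPair False (closedStrip ∩ ⋂ i ∈ T, R i) (fun p => ∑ i ∈ T, u i p)
      (fun p => ∑ i ∈ T, v i p) := by
  induction T using Finset.induction_on with
  | empty => simpa using stripPair_linear 0 0 0
  | insert i T hi ih =>
    have := ((h i).add ih).congr_nontrivial (N₁ := False) False.elim
    have hset : R i ∩ (closedStrip ∩ ⋂ j ∈ T, R j) = closedStrip ∩ ⋂ j ∈ insert i T, R j := by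
      rw [Finset.set_biInter_insert]; exact inter_left_comm _ _ _
    rw [hset] at this
    simpa only [Finset.sum_insert hi] using this

/-- Locally uniformly convergent sums of strip pairs. -/
theorem tsum (h : ∀ i, StripPair True (R i) (u i) (v i))
    (hb : ∀ X : ℝ, ∃ (T : Finset ι) (b : ι → ℝ), Summable b ∧ ∀ i ∉ T, ∀ p ∈ closedStrip,
      p.1 < X → p ∈ R i ∧ |u i p| ≤ b i ∧ |v i p| ≤ b i) :
    StripPair (Nonempty ι) (closedStrip ∩ ⋂ i, R i) (fun p => ∑' i, u i p)
      (fun p => ∑' i, v i p) := by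
  classical
  have hmem : ∀ {p}, p ∈ closedStrip ∩ ⋂ i, R i → ∀ i, p ∈ R i := fun hp i => mem_iInter.1 hp.2 i
  have hsum : ∀ p ∈ closedStrip, Summable (fun i => u i p) ∧ Summable (fun i => v i p) := by
    intro p hp
    obtain ⟨T, b, hbs, hT⟩ := hb (p.1 + 1)
    exact ⟨(summable_and_tsum_eq_of_bound T hbs fun i hi => (hT i hi p hp (by linarith)).2.1).1,
      (summable_and_tsum_eq_of_bound T hbs fun i hi => (hT i hi p hp (by linarith)).2.2).1⟩
  have hcross : ∀ p ∈ closedStrip, ∀ q ∈ closedStrip,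
      HasSum (fun i => crossForm (u i) (v i) p q)
        (crossForm (fun p => ∑' i, u i p) (fun p => ∑' i, v i p) p q) := fun p hp q hq =>
    (((hsum q hq).2.hasSum.sub (hsum p hp).2.hasSum).mul_right _).sub
      (((hsum q hq).1.hasSum.sub (hsum p hp).1.hasSum).mul_right _)
  have hsplit : ∀ f : ι → ℝ × ℝ → ℝ, (∀ i, ContinuousOn (f i) (R i)) → ∀ X, ∀ T : Finset ι,
      ∀ b : ι → ℝ, Summable b → (∀ i ∉ T, ∀ p ∈ closedStrip, p.1 < X → p ∈ R i ∧ |f i p| ≤ b i) →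
      ∃ g : ℝ × ℝ → ℝ, ContinuousOn g (closedStrip ∩ {p | p.1 < X}) ∧
        ∀ p ∈ closedStrip, p.1 < X → ∑ i ∈ T, f i p + g p = ∑' i, f i p := by
    intro f hf X T b hbs hT
    refine ⟨fun p => ∑' i, if i ∈ T then 0 else f i p, ?_, fun p hp hX =>
      (summable_and_tsum_eq_of_bound T hbs fun i hi => (hT i hi p hp hX).2).2.symm⟩
    refine continuousOn_tsum (u := fun i => |b i|) (fun i => ?_) hbs.abs fun i p hp => ?_
    · split_ifs with hi
      · exact continuousOn_const
      · exact (hf i).mono fun p hp => (hT i hi p hp.1 hp.2).1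
    · split_ifs with hi
      · simp
      · exact ((hT i hi p hp.1 hp.2).2).trans (le_abs_self _)
  have hnhds : ∀ (p : ℝ × ℝ) (S : Set (ℝ × ℝ)), 𝓝[S ∩ {q | q.1 < p.1 + 1}] p = 𝓝[S] p :=
    fun p S => nhdsWithin_inter_of_mem' (mem_nhdsWithin_of_mem_nhds
      ((isOpen_lt continuous_fst continuous_const).mem_nhds (by simp)))
  have hle : ∀ (p : ℝ × ℝ), 𝓝[closedStrip ∩ ⋂ i, R i] p ≤
      𝓝[closedStrip ∩ {q | q.1 < p.1 + 1}] p := fun p => by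
    rw [hnhds]; exact nhdsWithin_mono _ inter_subset_left
  have hleT : ∀ (p : ℝ × ℝ) (T : Finset ι), 𝓝[closedStrip ∩ ⋂ i, R i] p ≤
      𝓝[closedStrip ∩ ⋂ i ∈ T, R i] p := fun p T =>
    nhdsWithin_mono _ fun q hq => ⟨hq.1, mem_iInter₂.2 fun i _ => hmem hq i⟩
  have hev : ∀ p : ℝ × ℝ, ∀ᶠ q in 𝓝[closedStrip ∩ ⋂ i, R i] p, q ∈ closedStrip ∧ q.1 < p.1 + 1 :=
    fun p => by
      have := hle p self_mem_nhdsWithin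
      exact this
  have hcont : ∀ f : ι → ℝ × ℝ → ℝ, (∀ i, ContinuousOn (f i) (R i)) →
      (∀ X, ∃ (T : Finset ι) (b : ι → ℝ), Summable b ∧
        (∀ i ∉ T, ∀ p ∈ closedStrip, p.1 < X → p ∈ R i ∧ |f i p| ≤ b i)) →
      ContinuousOn (fun p => ∑' i, f i p) (closedStrip ∩ ⋂ i, R i) := by
    intro f hf hfb p hp
    obtain ⟨T, b, hbs, hT⟩ := hfb (p.1 + 1)
    obtain ⟨g, hg, hgs⟩ := hsplit f hf (p.1 + 1) T b hbs hT
    have h1 : Tendsto g (𝓝[closedStrip ∩ ⋂ i, R i] p) (𝓝 (g p)) :=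
      (hg p ⟨hp.1, by simp⟩).mono_left (hle p)
    have h2 : Tendsto (fun q => ∑ i ∈ T, f i q) (𝓝[closedStrip ∩ ⋂ i, R i] p)
        (𝓝 (∑ i ∈ T, f i p)) := tendsto_finsetSum _ fun i _ =>
      (hf i p (hmem hp i)).mono_left (nhdsWithin_mono _ fun q hq => hmem hq i)
    have h3 := h2.add h1
    rw [hgs p hp.1 (by simp)] at h3
    exact h3.congr' ((hev p).mono fun q hq => hgs q hq.1 hq.2)
  -- Near a singular point the series is a finite sum, singular at that point, plus a tail that
  -- stays finite.
  have hblow : ∀ p ∈ closedStrip, p ∉ closedStrip ∩ ⋂ i, R i → ∃ (T : Finset ι) (g : ℝ × ℝ → ℝ),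
      p ∉ closedStrip ∩ ⋂ i ∈ T, R i ∧ Tendsto g (𝓝[closedStrip ∩ ⋂ i, R i] p) (𝓝 (g p)) ∧
      ∀ᶠ q in 𝓝[closedStrip ∩ ⋂ i, R i] p, ∑ i ∈ T, u i q + g q = ∑' i, u i q := by
    intro p hp hpR
    obtain ⟨T, b, hbs, hT⟩ := hb (p.1 + 1)
    obtain ⟨g, hg, hgs⟩ := hsplit u (fun i => (h i).cont_u) (p.1 + 1) T b hbs fun i hi q hq hX =>
      ⟨(hT i hi q hq hX).1, (hT i hi q hq hX).2.1⟩
    refine ⟨T, g, fun hpT => hpR ⟨hp, mem_iInter.2 fun i => ?_⟩,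
      (hg p ⟨hp, by simp⟩).mono_left (hle p), (hev p).mono fun q hq => hgs q hq.1 hq.2⟩
    by_cases hi : i ∈ T
    · exact mem_iInter₂.1 hpT.2 i hi
    · exact (hT i hi p hp (by linarith)).1
  have hpi := Real.pi_pos.le
  have lower : ∀ x : ℝ, (x, (0 : ℝ)) ∈ closedStrip := fun x => ⟨le_rfl, hpi⟩
  have upper : ∀ x : ℝ, (x, Real.pi) ∈ closedStrip := fun x => ⟨hpi, le_rfl⟩
  exact {
    snd_nonneg := fun p hp => hp.1.1
    snd_le := fun p hp => hp.1.2
    interior_mem := fun p h₀ h₁ =>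
      ⟨⟨h₀.le, h₁.le⟩, mem_iInter.2 fun i => (h i).interior_mem p h₀ h₁⟩
    cont_u := hcont u (fun i => (h i).cont_u) fun X => by
      obtain ⟨T, b, hbs, hT⟩ := hb X
      exact ⟨T, b, hbs, fun i hi q hq hX => ⟨(hT i hi q hq hX).1, (hT i hi q hq hX).2.1⟩⟩
    cont_v := hcont v (fun i => (h i).cont_v) fun X => by
      obtain ⟨T, b, hbs, hT⟩ := hb X
      exact ⟨T, b, hbs, fun i hi q hq hX => ⟨(hT i hi q hq hX).1, (hT i hi q hq hX).2.2⟩⟩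
    nonneg := fun p hp q hq => (hcross p hp.1 q hq.1).nonneg fun i =>
      (h i).nonneg p (hmem hp i) q (hmem hq i)
    pos := fun ⟨i⟩ p hp q hq hpq hs => by
      rw [← (hcross p hp.1 q hq.1).tsum_eq]
      exact (hcross p hp.1 q hq.1).summable.tsum_pos
        (fun j => (h j).nonneg p (hmem hp j) q (hmem hq j)) i
        ((h i).pos trivial p (hmem hp i) q (hmem hq i) hpq hs)
    tendsto_lower := fun x hx => by
      obtain ⟨T, g, hT, hg, heq⟩ := hblow _ (lower x) hx
      exact ((((finsetSum h T).tendsto_lower x hT).mono_left (hleT _ T)).atTop_add hg).congr' heq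
    tendsto_upper := fun x hx => by
      obtain ⟨T, g, hT, hg, heq⟩ := hblow _ (upper x) hx
      exact ((((finsetSum h T).tendsto_upper x hT).mono_left (hleT _ T)).atBot_add hg).congr' heq
    v_lower := fun s t hst hx => tsum_congr fun i => (h i).v_lower s t hst fun x m => hmem (hx x m) i
    v_upper := fun s t hst hx => tsum_congr fun i => (h i).v_upper s t hst fun x m => hmem (hx x m) i
    convex := fun m d hd hx => hasSum_le
      (fun i => (h i).convex m d hd fun x m => hmem (hx x m) i)
      ((hsum _ (lower m)).1.hasSum.mul_left 2)
      ((hsum _ (lower _)).1.hasSum.add (hsum _ (lower _)).1.hasSum)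
    strict_convex := fun ⟨i⟩ m d hd hx => hasSum_lt
      (fun i => (h i).convex m d hd fun x m => hmem (hx x m) i)
      ((h i).strict_convex trivial m d hd fun x m => hmem (hx x m) i)
      ((hsum _ (lower m)).1.hasSum.mul_left 2)
      ((hsum _ (lower _)).1.hasSum.add (hsum _ (lower _)).1.hasSum)
    concave := fun m d hd hx => hasSum_le
      (fun i => (h i).concave m d hd fun x m => hmem (hx x m) i)
      ((hsum _ (upper _)).1.hasSum.add (hsum _ (upper _)).1.hasSum)
      ((hsum _ (upper m)).1.hasSum.mul_left 2)
    strict_concave := fun ⟨i⟩ m d hd hx => hasSum_lt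
      (fun i => (h i).concave m d hd fun x m => hmem (hx x m) i)
      ((h i).strict_concave trivial m d hd fun x m => hmem (hx x m) i)
      ((hsum _ (upper _)).1.hasSum.add (hsum _ (upper _)).1.hasSum)
      ((hsum _ (upper m)).1.hasSum.mul_left 2) }

end StripPair

/-! ### Logarithms of the infinite products -/

namespace FactorFamily

variable (F : FactorFamily)

/-- `log |∏ (1 + z / a_ν) ^ κ_ν|` at `z = exp (x + i y)`. -/
noncomputable def logAbs (p : ℝ × ℝ) : ℝ := ∑' i, F.expo i * Real.log ‖linFactor (F.pt i) p‖

/-- `arg ∏ (1 + z / a_ν) ^ κ_ν` at `z = exp (x + i y)`. -/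
noncomputable def argSum (p : ℝ × ℝ) : ℝ := ∑' i, F.expo i * (linFactor (F.pt i) p).arg

def regular : Set (ℝ × ℝ) := closedStrip ∩ ⋂ i, logRegular (F.pt i)

theorem exists_bound (X : ℝ) : ∃ (T : Finset F.Idx) (b : F.Idx → ℝ), Summable b ∧
    ∀ i ∉ T, ∀ p ∈ closedStrip, p.1 < X → p ∈ logRegular (F.pt i) ∧
      |F.expo i * Real.log ‖linFactor (F.pt i) p‖| ≤ b i ∧
      |F.expo i * (linFactor (F.pt i) p).arg| ≤ b i := by
  -- All but finitely many points are at least `2 e^X`. For these `|z / a| ≤ 1 / 2`, where `|log (1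
  -- + w)| ≤ 3 / 2 * |w|`.
  have hfin := F.tendsto_pt.eventually (eventually_ge_atTop (2 * Real.exp X))
  rw [eventually_cofinite] at hfin
  refine ⟨hfin.toFinset, fun i => 3 / 2 * Real.exp X * (F.expo i / F.pt i),
    F.summable_div.mul_left _, fun i hi p hp hX => ?_⟩
  have hi' : 2 * Real.exp X ≤ F.pt i := by simpa using hi
  have hpt := F.pt_pos i
  have hk := F.expo_pos i
  have hexp : Real.exp p.1 < Real.exp X := Real.exp_lt_exp.2 hX
  have hn : ‖Complex.exp (toC p) / (F.pt i : ℂ)‖ = Real.exp p.1 / F.pt i := by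
    rw [norm_div, Complex.norm_exp, Complex.norm_real, Real.norm_of_nonneg hpt.le]; rfl
  have hhalf : Real.exp p.1 / F.pt i ≤ 1 / 2 := by
    rw [div_le_div_iff₀ hpt two_pos]; linarith
  have hlog : ‖Complex.log (linFactor (F.pt i) p)‖ ≤ 3 / 2 * (Real.exp X / F.pt i) := by
    have := Complex.norm_log_one_add_half_le_self (hn.trans_le hhalf)
    rw [hn] at this
    refine this.trans ?_
    gcongr
  have hfinal : F.expo i * (3 / 2 * (Real.exp X / F.pt i)) =
      3 / 2 * Real.exp X * (F.expo i / F.pt i) := by ring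
  refine ⟨⟨hp, fun e => ?_⟩, ?_, ?_⟩
  · linarith [e.2, Real.exp_pos X]
  · beta_reduce
    rw [abs_mul, abs_of_pos hk, ← hfinal, ← Complex.log_re]
    gcongr
    exact (Complex.abs_re_le_norm _).trans hlog
  · beta_reduce
    rw [abs_mul, abs_of_pos hk, ← hfinal, ← Complex.log_im]
    gcongr
    exact (Complex.abs_im_le_norm _).trans hlog

theorem stripPair : StripPair (Nonempty F.Idx) F.regular F.logAbs F.argSum :=
  StripPair.tsum (fun i => stripPair_log (F.pt_pos i) (F.expo_pos i)) F.exists_bound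

theorem summable_logAbs {p : ℝ × ℝ} (hp : p ∈ closedStrip) :
    Summable fun i => F.expo i * Real.log ‖linFactor (F.pt i) p‖ := by
  classical
  obtain ⟨T, b, hb, h⟩ := F.exists_bound (p.1 + 1)
  exact (summable_and_tsum_eq_of_bound T hb fun i hi => (h i hi p hp (by linarith)).2.1).1

theorem summable_argSum {p : ℝ × ℝ} (hp : p ∈ closedStrip) :
    Summable fun i => F.expo i * (linFactor (F.pt i) p).arg := by
  classical
  obtain ⟨T, b, hb, h⟩ := F.exists_bound (p.1 + 1)
  exact (summable_and_tsum_eq_of_bound T hb fun i hi => (h i hi p hp (by linarith)).2.2).1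

end FactorFamily

namespace FactorFamily

variable (F : FactorFamily)

/-- `log ∏ (1 + z / a_ν) ^ κ_ν` at `z = exp (x + i y)`. -/
noncomputable def logSum (p : ℝ × ℝ) : ℂ := ⟨F.logAbs p, F.argSum p⟩

theorem hasSum_logSum {p : ℝ × ℝ} (hp : p ∈ closedStrip) :
    HasSum (fun i => Complex.log (linFactor (F.pt i) p) * (F.expo i : ℂ)) (F.logSum p) := by
  rw [Complex.hasSum_iff]
  constructor
  · simpa [logSum, logAbs, mul_comm, Complex.log_re] using (F.summable_logAbs hp).hasSum
  · simpa [logSum, argSum, mul_comm, Complex.log_im] using (F.summable_argSum hp).hasSum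

theorem linFactor_im_pos {p : ℝ × ℝ} (h₀ : 0 < p.2) (h₁ : p.2 < Real.pi) (i : F.Idx) :
    0 < (linFactor (F.pt i) p).im := by
  rw [linFactor_im]
  have := F.pt_pos i
  have := Real.sin_pos_of_pos_of_lt_pi h₀ h₁
  positivity

theorem tprod_linFactor {p : ℝ × ℝ} (h₀ : 0 < p.2) (h₁ : p.2 < Real.pi) :
    ∏' i, linFactor (F.pt i) p ^ (F.expo i : ℂ) = Complex.exp (F.logSum p) := by
  rw [← (F.hasSum_logSum ⟨h₀.le, h₁.le⟩).cexp.tprod_eq]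
  refine tprod_congr fun i => ?_
  have hne : linFactor (F.pt i) p ≠ 0 := fun e => by
    have := F.linFactor_im_pos h₀ h₁ i
    rw [e] at this; simp at this
  rw [Complex.cpow_def_of_ne_zero hne]; rfl

/-- In the open strip each factor lies off the real axis, so conjugation commutes with its principal
logarithm. -/
theorem tprod_conj_linFactor {p : ℝ × ℝ} (h₀ : 0 < p.2) (h₁ : p.2 < Real.pi) :
    ∏' i, starRingEnd ℂ (linFactor (F.pt i) p) ^ (F.expo i : ℂ) =
      Complex.exp (starRingEnd ℂ (F.logSum p)) := by
  have h := Complex.hasSum_conj'.2 (F.hasSum_logSum ⟨h₀.le, h₁.le⟩)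
  rw [← h.cexp.tprod_eq]
  refine tprod_congr fun i => ?_
  have him := F.linFactor_im_pos h₀ h₁ i
  have hne : linFactor (F.pt i) p ≠ 0 := fun e => by
    rw [e] at him; simp at him
  have harg : (linFactor (F.pt i) p).arg ≠ Real.pi := fun e => by
    rw [Complex.arg_eq_pi_iff] at e; exact him.ne' e.2
  rw [Complex.cpow_def_of_ne_zero ((map_ne_zero _).2 hne), Complex.log_conj _ harg,
    Function.comp_apply, map_mul, Complex.conj_ofReal]

end FactorFamily

/-- In terms of `z = exp ζ`, `flipX` is `z ↦ 1 / conj z` and `flipY` is `z ↦ -conj z`. Up to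
conjugation, these turn all four products into the product of the `1 + z / a`. -/
theorem exp_toC_flipX (p : ℝ × ℝ) :
    Complex.exp (toC (flipX p)) = starRingEnd ℂ (1 / Complex.exp (toC p)) := by
  rw [one_div, ← Complex.exp_neg, ← Complex.exp_conj]
  congr 1
  apply Complex.ext <;> simp [toC, flipX]

theorem exp_toC_flipY (p : ℝ × ℝ) :
    Complex.exp (toC (flipY p)) = -starRingEnd ℂ (Complex.exp (toC p)) := by
  have : toC (flipY p) = starRingEnd ℂ (toC p) + Real.pi * Complex.I := by
    apply Complex.ext
    · simp [toC, flipY]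
    · simp [toC, flipY]; ring
  rw [this, Complex.exp_add, Complex.exp_pi_mul_I, Complex.exp_conj]
  ring

theorem linFactor_eq_conj (a : ℝ) (p : ℝ × ℝ) {w : ℂ}
    (h : Complex.exp (toC p) = starRingEnd ℂ w) :
    1 + w / (a : ℂ) = starRingEnd ℂ (linFactor a p) := by
  rw [linFactor, h]; simp

namespace FactorFamily

variable (F : FactorFamily)

theorem prodAdd_exp {p : ℝ × ℝ} (h₀ : 0 < p.2) (h₁ : p.2 < Real.pi) :
    F.prodAdd (Complex.exp (toC p)) = Complex.exp (F.logSum p) :=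
  F.tprod_linFactor h₀ h₁

theorem prodSub_exp {p : ℝ × ℝ} (h₀ : 0 < p.2) (h₁ : p.2 < Real.pi) :
    F.prodSub (Complex.exp (toC p)) = Complex.exp (starRingEnd ℂ (F.logSum (flipY p))) := by
  rw [← F.tprod_conj_linFactor (p := flipY p) (by simp only [flipY]; linarith)
    (by simp only [flipY]; linarith)]
  refine tprod_congr fun i => ?_
  rw [← linFactor_eq_conj (F.pt i) (flipY p) (w := -Complex.exp (toC p))
    (by rw [exp_toC_flipY, map_neg]), neg_div, sub_eq_add_neg]

theorem prodAdd_inv_exp {p : ℝ × ℝ} (h₀ : 0 < p.2) (h₁ : p.2 < Real.pi) :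
    F.prodAdd (1 / Complex.exp (toC p)) = Complex.exp (starRingEnd ℂ (F.logSum (flipX p))) := by
  rw [← F.tprod_conj_linFactor (p := flipX p) h₀ h₁]
  refine tprod_congr fun i => ?_
  rw [← linFactor_eq_conj (F.pt i) (flipX p) (exp_toC_flipX p)]

theorem prodSub_inv_exp {p : ℝ × ℝ} (h₀ : 0 < p.2) (h₁ : p.2 < Real.pi) :
    F.prodSub (1 / Complex.exp (toC p)) = Complex.exp (F.logSum (flipY (flipX p))) := by
  rw [← F.tprod_linFactor (p := flipY (flipX p)) (by simp only [flipY, flipX]; linarith)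
    (by simp only [flipY, flipX]; linarith)]
  refine tprod_congr fun i => ?_
  rw [linFactor, exp_toC_flipY, exp_toC_flipX, Complex.conj_conj, neg_div, sub_eq_add_neg]

end FactorFamily

/-! ### The logarithm of `W` in the strip -/

namespace WData

variable (D : WData)

/-- `log |W|` at `exp (x + i y)`. -/
noncomputable def logAbs (p : ℝ × ℝ) : ℝ :=
  ((((D.C.re + D.B * p.1) + D.A * (Real.exp p.1 * Real.cos p.2)) +
    -(D.A₀ * (Real.exp (flipY (flipX p)).1 * Real.cos (flipY (flipX p)).2))) +
    (D.a.logAbs p + -D.b.logAbs (flipY p))) +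
    (D.c.logAbs (flipX p) + -D.d.logAbs (flipY (flipX p)))

/-- `arg W` at `exp (x + i y)`. -/
noncomputable def argSum (p : ℝ × ℝ) : ℝ :=
  ((((D.C.im + D.B * p.2) + D.A * (Real.exp p.1 * Real.sin p.2)) +
    -(D.A₀ * (Real.exp (flipY (flipX p)).1 * Real.sin (flipY (flipX p)).2))) +
    (D.a.argSum p + D.b.argSum (flipY p))) +
    (-D.c.argSum (flipX p) + -D.d.argSum (flipY (flipX p)))

/-- `log W` at `exp (x + i y)`. -/
noncomputable def logW (p : ℝ × ℝ) : ℂ := ⟨D.logAbs p, D.argSum p⟩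

theorem W_exp {p : ℝ × ℝ} (h₀ : 0 < p.2) (h₁ : p.2 < Real.pi) :
    D.W (Complex.exp (toC p)) = Complex.exp (D.logW p) := by
  rw [W, D.a.prodAdd_exp h₀ h₁, D.b.prodSub_exp h₀ h₁, D.c.prodAdd_inv_exp h₀ h₁,
    D.d.prodSub_inv_exp h₀ h₁, Complex.cpow_def_of_ne_zero (Complex.exp_ne_zero _),
    Complex.log_exp (by simp only [toC]; linarith) (by simp only [toC]; linarith),
    ← Complex.exp_sub, ← Complex.exp_sub, ← Complex.exp_add, ← Complex.exp_add, ← Complex.exp_add,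
    div_eq_mul_inv, ← Complex.exp_neg]
  congr 1
  apply Complex.ext
  · simp [logW, logAbs, FactorFamily.logSum, toC, Complex.exp_re, Complex.exp_im, flipX, flipY]
    ring
  · simp [logW, argSum, FactorFamily.logSum, toC, Complex.exp_re, Complex.exp_im, flipX, flipY]
    ring

theorem nontrivial_of_exists
    (hW : ∃ z ∈ upperHalf, D.W z ≠ Complex.exp D.C * z ^ (D.B : ℂ)) :
    0 < D.A ∨ 0 < D.A₀ ∨ Nonempty D.a.Idx ∨ Nonempty D.b.Idx ∨ Nonempty D.c.Idx ∨
      Nonempty D.d.Idx := by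
  by_contra! hcon
  obtain ⟨hA, hA₀, ha, hb, hc, hd⟩ := hcon
  obtain ⟨z, _, hz⟩ := hW
  refine hz ?_
  rw [W, le_antisymm hA D.A_nonneg, le_antisymm hA₀ D.A₀_nonneg]
  simp [FactorFamily.prodAdd, FactorFamily.prodSub]

/-- The signs match because `reflectY` negates `u` and `reflectX` negates `v`. Strictness comes from
whichever term other than `C + B ζ` is present. -/
theorem exists_stripPair
    (hW : ∃ z ∈ upperHalf, D.W z ≠ Complex.exp D.C * z ^ (D.B : ℂ)) :
    ∃ R, StripPair True R D.logAbs D.argSum := by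
  have hN := D.nontrivial_of_exists hW
  have h := (((((stripPair_linear D.B D.C.re D.C.im).add (stripPair_exp D.A_nonneg)).add
    (stripPair_exp D.A₀_nonneg).reflectY.reflectX).add
    (D.a.stripPair.add D.b.stripPair.reflectY)).add
    (D.c.stripPair.reflectX.add D.d.stripPair.reflectY.reflectX))
  exact ⟨_, h.congr_nontrivial fun _ => by tauto⟩

end WData

/-! ### Passage between the half-plane and the strip -/

/-- The coordinates `(log ‖z‖, arg z)`. -/
noncomputable def logPolar (z : ℂ) : ℝ × ℝ := (Real.log ‖z‖, z.arg)

theorem toC_logPolar (z : ℂ) : toC (logPolar z) = Complex.log z :=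
  Complex.ext (Complex.log_re z).symm (Complex.log_im z).symm

theorem exp_toC_logPolar {z : ℂ} (hz : z ≠ 0) : Complex.exp (toC (logPolar z)) = z := by
  rw [toC_logPolar, Complex.exp_log hz]

theorem logPolar_exp {p : ℝ × ℝ} (hp : p ∈ closedStrip) :
    logPolar (Complex.exp (toC p)) = p := by
  have h : Complex.log (Complex.exp (toC p)) = toC p :=
    Complex.log_exp (by linarith [hp.1, Real.pi_pos, show (toC p).im = p.2 from rfl]) hp.2
  have h2 := toC_logPolar (Complex.exp (toC p))
  rw [h] at h2
  exact Prod.ext (congrArg Complex.re h2) (congrArg Complex.im h2)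

theorem logPolar_snd_pos {z : ℂ} (hz : z ∈ upperHalf) : 0 < (logPolar z).2 :=
  lt_of_le_of_ne (Complex.arg_nonneg_iff.2 (le_of_lt hz)) fun e =>
    (ne_of_gt hz) (Complex.arg_eq_zero_iff.1 e.symm).2

theorem logPolar_snd_lt {z : ℂ} (hz : z ∈ upperHalf) : (logPolar z).2 < Real.pi :=
  Complex.arg_lt_pi_iff.2 (Or.inr (ne_of_gt hz))

theorem ne_zero_of_mem_upperHalf {z : ℂ} (hz : z ∈ upperHalf) : z ≠ 0 := fun e => by
  rw [e] at hz; exact lt_irrefl (0 : ℝ) hz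

theorem upperHalf_subset : upperHalf ⊆ {z : ℂ | 0 ≤ z.im} :=
  fun _ hz => Set.mem_ofPred.2 (le_of_lt hz)

theorem exp_toC_mem_upperHalf {p : ℝ × ℝ} (h₀ : 0 < p.2) (h₁ : p.2 < Real.pi) :
    Complex.exp (toC p) ∈ upperHalf :=
  Complex.exp_im_pos ⟨h₀, h₁⟩

theorem norm_exp_toC (p : ℝ × ℝ) : ‖Complex.exp (toC p)‖ = Real.exp p.1 := Complex.norm_exp _

theorem nhdsWithin_upperHalf_neBot {z : ℂ} (hz : 0 ≤ z.im) : (𝓝[upperHalf] z).NeBot := by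
  refine mem_closure_iff_nhdsWithin_neBot.1 ?_
  rw [upperHalf, Complex.closure_setOfPred_lt_im]
  exact hz

theorem isPreconnected_upperHalf_inter_ball (r : ℝ) :
    IsPreconnected (upperHalf ∩ Metric.ball 0 r) :=
  ((convex_halfSpace_im_gt 0).inter (convex_ball 0 r)).isPreconnected

theorem isPreconnected_upperHalf : IsPreconnected upperHalf :=
  (convex_halfSpace_im_gt 0).isPreconnected

theorem exists_int_of_exp_eq_one {X : Type*} [TopologicalSpace X] {S : Set X}
    (hS : IsPreconnected S) {f : X → ℂ} (hf : ContinuousOn f S)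
    (h1 : ∀ z ∈ S, Complex.exp (f z) = 1) :
    ∃ k : ℤ, ∀ z ∈ S, f z = k * (2 * Real.pi * Complex.I) := by
  have hn : ∀ z ∈ S, ∃ n : ℤ, f z = n * (2 * Real.pi * Complex.I) := fun z hz =>
    Complex.exp_eq_one_iff.1 (h1 z hz)
  choose! n hn using hn
  have hpi := Real.pi_pos
  have him : ∀ z ∈ S, (f z).im / (2 * Real.pi) = n z := fun z hz => by
    rw [hn z hz]; simp
  have key : ∀ z ∈ S, ∀ w ∈ S, ¬ n z < n w := by
    intro z hz w hw hlt
    have hcont : ContinuousOn (fun z => (f z).im / (2 * Real.pi)) S :=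
      (Complex.continuous_im.comp_continuousOn hf).div_const _
    have hle : (n z : ℝ) + 1 ≤ n w := by exact_mod_cast hlt
    -- Two different integer values would force a half-integer value in between.
    have hmem : (n z : ℝ) + 1 / 2 ∈ Icc ((f z).im / (2 * Real.pi)) ((f w).im / (2 * Real.pi)) := by
      rw [him z hz, him w hw]; constructor <;> linarith
    obtain ⟨y, hy, hyv⟩ := hS.intermediate_value hz hw hcont hmem
    simp only [him y hy] at hyv
    have : ((2 * n y : ℤ) : ℝ) = ((2 * n z + 1 : ℤ) : ℝ) := by push_cast; linarith
    have := Int.cast_injective this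
    omega
  rcases S.eq_empty_or_nonempty with rfl | ⟨z₀, hz₀⟩
  · exact ⟨0, fun z hz => absurd hz (Set.notMem_empty z)⟩
  · refine ⟨n z₀, fun z hz => ?_⟩
    rw [hn z hz, le_antisymm (not_lt.1 (key z₀ hz₀ z hz)) (not_lt.1 (key z hz z₀ hz₀))]

namespace WData

variable {D : WData} {R : Set (ℝ × ℝ)} {N : Prop}

theorem W_eq_exp {z : ℂ} (hz : z ∈ upperHalf) : D.W z = Complex.exp (D.logW (logPolar z)) := by
  rw [← D.W_exp (logPolar_snd_pos hz) (logPolar_snd_lt hz),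
    exp_toC_logPolar (ne_zero_of_mem_upperHalf hz)]

theorem tendsto_logPolar (h : StripPair N R D.logAbs D.argSum) {z : ℂ} (hz : z ≠ 0) :
    Tendsto logPolar (𝓝[upperHalf] z) (𝓝[R] (logPolar z)) := by
  refine tendsto_nhdsWithin_iff.2 ⟨?_, eventually_nhdsWithin_of_forall fun w hw =>
    h.interior_mem _ (logPolar_snd_pos hw) (logPolar_snd_lt hw)⟩
  have hlog : Tendsto Complex.log (𝓝[upperHalf] z) (𝓝 (Complex.log z)) :=
    (continuousWithinAt_log_of_im_nonneg hz).mono_left (nhdsWithin_mono _ upperHalf_subset)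
  have h1 := (Complex.continuous_re.tendsto _).comp hlog
  have h2 := (Complex.continuous_im.tendsto _).comp hlog
  have h3 := h1.prodMk_nhds h2
  simp only [Function.comp_def, Complex.log_re, Complex.log_im] at h3
  exact h3

theorem continuousOn_logW (h : StripPair N R D.logAbs D.argSum) : ContinuousOn D.logW R := by
  have : D.logW = fun p => (D.logAbs p : ℂ) + D.argSum p * Complex.I := by
    funext p; exact Complex.ext (by simp [logW]) (by simp [logW])
  rw [this]
  exact (Complex.continuous_ofReal.comp_continuousOn h.cont_u).add
    ((Complex.continuous_ofReal.comp_continuousOn h.cont_v).mul continuousOn_const)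

theorem tendsto_logW (h : StripPair N R D.logAbs D.argSum) {z : ℂ} (hz : z ≠ 0)
    (hR : logPolar z ∈ R) :
    Tendsto (fun w => D.logW (logPolar w)) (𝓝[upperHalf] z) (𝓝 (D.logW (logPolar z))) :=
  (continuousOn_logW h _ hR).tendsto.comp (tendsto_logPolar h hz)

theorem continuousOn_logW_logPolar (h : StripPair N R D.logAbs D.argSum) :
    ContinuousOn (fun w => D.logW (logPolar w)) upperHalf := fun _ hz =>
  tendsto_logW h (ne_zero_of_mem_upperHalf hz)
    (h.interior_mem _ (logPolar_snd_pos hz) (logPolar_snd_lt hz))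

theorem tendsto_W (h : StripPair N R D.logAbs D.argSum) {z : ℂ} (hz : z ≠ 0)
    (hR : logPolar z ∈ R) :
    Tendsto D.W (𝓝[upperHalf] z) (𝓝 (Complex.exp (D.logW (logPolar z)))) :=
  ((Complex.continuous_exp.tendsto _).comp (tendsto_logW h hz hR)).congr'
    (eventually_nhdsWithin_of_forall fun _ hw => (W_eq_exp hw).symm)

theorem takesValue_of_mem (h : StripPair N R D.logAbs D.argSum) {p : ℝ × ℝ} (hp : p ∈ R) :
    D.TakesValue (Complex.exp (toC p)) (Complex.exp (D.logW p)) := by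
  have hs : p ∈ closedStrip := ⟨h.snd_nonneg p hp, h.snd_le p hp⟩
  have him : 0 ≤ (Complex.exp (toC p)).im := Complex.exp_im_nonneg hs
  rcases him.lt_or_eq with h0 | h0
  · refine Or.inl ⟨h0, ?_⟩
    rw [W_eq_exp h0, logPolar_exp hs]
  · have := tendsto_W h (Complex.exp_ne_zero (toC p)) (by rwa [logPolar_exp hs])
    rw [logPolar_exp hs] at this
    exact Or.inr ⟨h0.symm, this⟩

theorem tendsto_log_norm {z w : ℂ} (hw : w ≠ 0) (hz : Tendsto D.W (𝓝[upperHalf] z) (𝓝 w)) :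
    Tendsto (fun y => D.logAbs (logPolar y)) (𝓝[upperHalf] z) (𝓝 (Real.log ‖w‖)) := by
  refine (((Real.continuousAt_log (norm_ne_zero_iff.2 hw)).tendsto.comp hz.norm)).congr'
    (eventually_nhdsWithin_of_forall fun y hy => ?_)
  rw [Function.comp_apply, W_eq_exp hy, Complex.norm_exp, Real.log_exp]
  rfl

/-- At a singular boundary point `log |W|` tends to `±∞`, which excludes a finite nonzero boundary
value. For `w = 0` this would fail at the zeros on the negative axis. -/
theorem mem_of_takesValue (h : StripPair N R D.logAbs D.argSum) {z w : ℂ} (hz : z ≠ 0)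
    (hw : w ≠ 0) (hzw : D.TakesValue z w) :
    0 ≤ z.im ∧ logPolar z ∈ R ∧ Complex.exp (D.logW (logPolar z)) = w := by
  rcases hzw with ⟨him, e⟩ | ⟨him, e⟩
  · exact ⟨him.le, h.interior_mem _ (logPolar_snd_pos him) (logPolar_snd_lt him),
      by rw [← W_eq_exp him, e]⟩
  · have hne := nhdsWithin_upperHalf_neBot him.ge
    refine ⟨him.ge, ?_⟩
    have hR : logPolar z ∈ R := by
      by_contra hR
      have hlim := tendsto_log_norm hw e
      have hpol := tendsto_logPolar h hz
      have hsnd : (logPolar z).2 = 0 ∨ (logPolar z).2 = Real.pi := by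
        rcases le_or_gt 0 z.re with hre | hre
        · exact Or.inl (Complex.arg_eq_zero_iff.2 ⟨hre, him⟩)
        · exact Or.inr (Complex.arg_eq_pi_iff.2 ⟨hre, him⟩)
      rcases hsnd with hs | hs
      · have hp : logPolar z = ((logPolar z).1, 0) := Prod.ext rfl hs
        rw [hp] at hR hpol
        exact not_tendsto_nhds_of_tendsto_atTop ((h.tendsto_lower _ hR).comp hpol) _ hlim
      · have hp : logPolar z = ((logPolar z).1, Real.pi) := Prod.ext rfl hs
        rw [hp] at hR hpol
        exact not_tendsto_nhds_of_tendsto_atBot ((h.tendsto_upper _ hR).comp hpol) _ hlim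
    exact ⟨hR, tendsto_nhds_unique (tendsto_W h hz hR) e⟩

theorem logAbs_eq_of_exp {p : ℝ × ℝ} {w : ℂ} (hp : Complex.exp (D.logW p) = w) :
    D.logAbs p = Real.log ‖w‖ := by
  rw [← hp, Complex.norm_exp, Real.log_exp]; rfl

theorem mem_levelSet_of_takesValue (h : StripPair N R D.logAbs D.argSum) {z w : ℂ} (hz : z ≠ 0)
    (hw : w ≠ 0) (hzw : D.TakesValue z w) :
    logPolar z ∈ levelSet R D.logAbs (Real.log ‖w‖) := by
  obtain ⟨_, hR, he⟩ := mem_of_takesValue h hz hw hzw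
  exact ⟨hR, logAbs_eq_of_exp he⟩

theorem exp_logW_of_mem {p : ℝ × ℝ} {L : ℝ} (hp : p ∈ levelSet R D.logAbs L) :
    Complex.exp (D.logW p) = Complex.exp (L + D.argSum p * Complex.I) := by
  congr 1
  exact Complex.ext (by simp [logW, hp.2]) (by simp [logW])

/-- Every continuous branch of `log W` differs from `logW` by a constant. -/
theorem LogIncrement.exists_tendsto (h : StripPair N R D.logAbs D.argSum) {z₁ z₂ : ℂ} {θ : ℝ}
    (hl : D.LogIncrement z₁ z₂ θ) : ∃ γ : ℂ,
      Tendsto (fun w => D.logW (logPolar w)) (𝓝[upperHalf] z₁) (𝓝 γ) ∧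
      Tendsto (fun w => D.logW (logPolar w)) (𝓝[upperHalf] z₂) (𝓝 (γ + θ * Complex.I)) := by
  obtain ⟨ψ, β, hψ, hexp, h₁, h₂⟩ := hl
  obtain ⟨k, hk⟩ := exists_int_of_exp_eq_one isPreconnected_upperHalf
    (hψ.sub (continuousOn_logW_logPolar h)) fun z hz => by
      simp only [Pi.sub_apply]
      rw [Complex.exp_sub, hexp z hz, W_eq_exp hz, div_self (Complex.exp_ne_zero _)]
  have heq : ∀ z ∈ upperHalf, ψ z - k * (2 * Real.pi * Complex.I) = D.logW (logPolar z) :=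
    fun z hz => by rw [← hk z hz]; simp
  refine ⟨β - k * (2 * Real.pi * Complex.I),
    (h₁.sub_const _).congr' (eventually_nhdsWithin_of_forall heq), ?_⟩
  have := (h₂.sub_const (k * (2 * Real.pi * Complex.I))).congr'
    (eventually_nhdsWithin_of_forall heq)
  rwa [add_sub_right_comm] at this

/-- If `W` has a nonzero limit at the origin, then so does `log W`. -/
theorem exists_tendsto_logW_zero (h : StripPair N R D.logAbs D.argSum) {α : ℂ} (hα : α ≠ 0)
    (hlim : Tendsto D.W (𝓝[upperHalf] 0) (𝓝 α)) : ∃ γ : ℂ, Complex.exp γ = α ∧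
      Tendsto (fun w => D.logW (logPolar w)) (𝓝[upperHalf] 0) (𝓝 γ) := by
  have hq : Tendsto (fun z => D.W z / α) (𝓝[upperHalf] 0) (𝓝 1) := by
    simpa [div_self hα] using hlim.div_const α
  have hlog : Tendsto (fun z => Complex.log (D.W z / α)) (𝓝[upperHalf] 0) (𝓝 0) := by
    simpa using hq.clog Complex.one_mem_slitPlane
  have hev : ∀ᶠ z in 𝓝[upperHalf] (0 : ℂ), D.W z / α ∈ Complex.slitPlane :=
    hq.eventually (Complex.isOpen_slitPlane.mem_nhds Complex.one_mem_slitPlane)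
  obtain ⟨r, hr, hball⟩ := Metric.mem_nhdsWithin_iff.1 hev
  have hball' : ∀ z ∈ upperHalf ∩ Metric.ball 0 r, D.W z / α ∈ Complex.slitPlane :=
    fun z hz => hball ⟨hz.2, hz.1⟩
  have hWc : ContinuousOn D.W upperHalf :=
    (Complex.continuous_exp.comp_continuousOn (continuousOn_logW_logPolar h)).congr
      fun z hz => W_eq_exp hz
  -- Near the origin `W / α` is close to `1`, so its principal logarithm plus `log α` is a branch of
  -- `log W` on a half-disc. It differs from `logW` by a constant multiple of `2πi`.
  obtain ⟨k, hk⟩ := exists_int_of_exp_eq_one (isPreconnected_upperHalf_inter_ball r)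
    (f := fun z => D.logW (logPolar z) - Complex.log (D.W z / α) - Complex.log α)
    ((((continuousOn_logW_logPolar h).mono inter_subset_left).sub
      (((hWc.mono inter_subset_left).div_const α).clog hball')).sub continuousOn_const)
    fun z hz => by
      rw [Complex.exp_sub, Complex.exp_sub, ← W_eq_exp hz.1, Complex.exp_log hα,
        Complex.exp_log (Complex.slitPlane_ne_zero (hball' z hz))]
      have : D.W z ≠ 0 := by rw [W_eq_exp hz.1]; exact Complex.exp_ne_zero _
      field_simp
  refine ⟨Complex.log α + k * (2 * Real.pi * Complex.I), ?_, ?_⟩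
  · rw [Complex.exp_add, Complex.exp_log hα, Complex.exp_int_mul_two_pi_mul_I, mul_one]
  · have hmem : upperHalf ∩ Metric.ball 0 r ∈ 𝓝[upperHalf] (0 : ℂ) :=
      inter_mem self_mem_nhdsWithin (mem_nhdsWithin_of_mem_nhds (Metric.ball_mem_nhds _ hr))
    have := hlog.add_const (Complex.log α + k * (2 * Real.pi * Complex.I))
    rw [zero_add] at this
    refine this.congr' ?_
    filter_upwards [hmem] with z hz
    rw [← hk z hz]; ring

end WData

/-! ### End points and conclusion -/

namespace WData

variable {D : WData} {R : Set (ℝ × ℝ)}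

theorem real_sameSign_of_sameSide {z₁ z₂ : ℂ} (h₁ : z₁ ≠ 0) (h₂ : z₂ ≠ 0)
    (hs : SameSide (logPolar z₁) (logPolar z₂)) : z₁.im = 0 ∧ z₂.im = 0 ∧ 0 < z₁.re * z₂.re := by
  obtain ⟨e, e'⟩ := hs
  have pos : ∀ z : ℂ, z ≠ 0 → (logPolar z).2 = 0 → z.im = 0 ∧ 0 < z.re := fun z hz h => by
    obtain ⟨a, b⟩ := Complex.arg_eq_zero_iff.1 h
    exact ⟨b, lt_of_le_of_ne a fun e => hz (Complex.ext e.symm b)⟩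
  have neg : ∀ z : ℂ, (logPolar z).2 = Real.pi → z.im = 0 ∧ z.re < 0 := fun z h =>
    (Complex.arg_eq_pi_iff.1 h).symm
  rcases e' with e' | e'
  · obtain ⟨a, b⟩ := pos z₁ h₁ e'
    obtain ⟨a', b'⟩ := pos z₂ h₂ (e.symm.trans e')
    exact ⟨a, a', mul_pos b b'⟩
  · obtain ⟨a, b⟩ := neg z₁ e'
    obtain ⟨a', b'⟩ := neg z₂ (e.symm.trans e')
    exact ⟨a, a', mul_pos_of_neg_of_neg b b'⟩

theorem log_norm_lt {z₁ z₂ : ℂ} (h₁ : z₁ ≠ 0) (hz : ‖z₁‖ < ‖z₂‖) :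
    (logPolar z₁).1 < (logPolar z₂).1 :=
  Real.log_lt_log (norm_pos_iff.2 h₁) hz

/-- The arguments of `W` at the end points, and the values in between taken on the level set,
when the inner end point is not the origin. -/
theorem exists_start_of_ne_zero (h : StripPair True R D.logAbs D.argSum) {α : ℂ} (hα : α ≠ 0)
    {z₁ z₂ : ℂ} (h0 : z₁ ≠ 0) (hz : ‖z₁‖ < ‖z₂‖) (h₁ : D.TakesValue z₁ α) (him₂ : 0 ≤ z₂.im)
    (hp₂ : logPolar z₂ ∈ levelSet R D.logAbs (Real.log ‖α‖)) :
    ∃ v₁ : ℝ, Complex.exp (Real.log ‖α‖ + v₁ * Complex.I) = α ∧ v₁ ≤ D.argSum (logPolar z₂) ∧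
      (∀ θ : ℝ, D.LogIncrement z₁ z₂ θ → D.argSum (logPolar z₂) - v₁ = θ) ∧
      (v₁ = D.argSum (logPolar z₂) → (z₁.im = 0 ∧ z₂.im = 0 ∧ 0 < z₁.re * z₂.re) ∧
        ∀ z ∈ halfAnnulus z₁ z₂, ∀ w : ℂ, D.TakesValue z w → ‖w‖ ≠ ‖α‖) ∧
      ∀ c, v₁ < c → c < D.argSum (logPolar z₂) → ∃ r ∈ levelSet R D.logAbs (Real.log ‖α‖),
        ‖z₁‖ < Real.exp r.1 ∧ r.1 < (logPolar z₂).1 ∧ D.argSum r = c := by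
  have h2 : z₂ ≠ 0 := norm_pos_iff.1 ((norm_nonneg _).trans_lt hz)
  obtain ⟨him₁, hR₁, he₁⟩ := mem_of_takesValue h h0 hα h₁
  have hp₁ := mem_levelSet_of_takesValue h h0 hα h₁
  have hlt := log_norm_lt h0 hz
  refine ⟨D.argSum (logPolar z₁), by rw [← exp_logW_of_mem hp₁, he₁],
    h.v_le_of_levelSet hp₁ hp₂ hlt, fun θ hl => ?_, fun hv => ⟨?_, ?_⟩, fun c hc hc' => ?_⟩
  · obtain ⟨γ, hγ₁, hγ₂⟩ := LogIncrement.exists_tendsto h hl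
    have := nhdsWithin_upperHalf_neBot him₁
    have := nhdsWithin_upperHalf_neBot him₂
    have e₁ := tendsto_nhds_unique hγ₁ (tendsto_logW h h0 hR₁)
    have e₂ := tendsto_nhds_unique hγ₂ (tendsto_logW h h2 hp₂.1)
    have e₃ := congrArg Complex.im e₂
    rw [e₁] at e₃
    simp [logW] at e₃
    linarith
  · refine real_sameSign_of_sameSide h0 h2 ?_
    by_contra hs
    exact (h.v_lt_of_not_sameSide hp₁ hp₂ hlt hs).ne hv
  · intro z hzA w hw hwα
    have hz0 : z ≠ 0 := norm_pos_iff.1 ((norm_nonneg _).trans_lt hzA.2.1)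
    have hw0 : w ≠ 0 := norm_ne_zero_iff.1 (hwα ▸ norm_ne_zero_iff.2 hα)
    have hq := mem_levelSet_of_takesValue h hz0 hw0 hw
    rw [hwα] at hq
    exact (h.v_lt_of_three hp₁ hq hp₂ (log_norm_lt h0 hzA.2.1) (log_norm_lt hz0 hzA.2.2)).ne hv
  · obtain ⟨r, hr, hr₁, hr₂, hrv⟩ := h.exists_levelSet_v_eq hp₁ hp₂ hlt hc hc'
    refine ⟨r, hr, ?_, hr₂, hrv⟩
    rw [← Real.exp_log (norm_pos_iff.2 h0)]
    exact Real.exp_lt_exp.2 hr₁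

/-- The arguments of `W` at the end points, and the values in between taken on the level set,
when the inner end point is the origin. -/
theorem exists_start_zero (h : StripPair True R D.logAbs D.argSum) {α : ℂ} (hα : α ≠ 0)
    {z₂ : ℂ} (hz : 0 < ‖z₂‖) (h₁ : D.TakesValue 0 α) (him₂ : 0 ≤ z₂.im)
    (hp₂ : logPolar z₂ ∈ levelSet R D.logAbs (Real.log ‖α‖)) :
    ∃ v₁ : ℝ, Complex.exp (Real.log ‖α‖ + v₁ * Complex.I) = α ∧ v₁ < D.argSum (logPolar z₂) ∧
      (∀ θ : ℝ, D.LogIncrement 0 z₂ θ → D.argSum (logPolar z₂) - v₁ = θ) ∧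
      ∀ c, v₁ < c → c < D.argSum (logPolar z₂) → ∃ r ∈ levelSet R D.logAbs (Real.log ‖α‖),
        r.1 < (logPolar z₂).1 ∧ D.argSum r = c := by
  have h2 : z₂ ≠ 0 := norm_pos_iff.1 hz
  have hlim : Tendsto D.W (𝓝[upperHalf] 0) (𝓝 α) := by
    rcases h₁ with h₁ | h₁
    · exact absurd h₁.1 (by simp)
    · exact h₁.2
  obtain ⟨γ, hγα, hγ⟩ := exists_tendsto_logW_zero h hα hlim
  have hγre : γ.re = Real.log ‖α‖ := by rw [← hγα, Complex.norm_exp, Real.log_exp]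
  have hclose : ∀ ε > 0, ∃ X, ∀ p : ℝ × ℝ, p.1 < X → 0 < p.2 → p.2 < Real.pi →
      ‖D.logW p - γ‖ ≤ ε := by
    intro ε hε
    obtain ⟨δ, hδ, hball⟩ := Metric.mem_nhdsWithin_iff.1 (hγ (Metric.closedBall_mem_nhds γ hε))
    refine ⟨Real.log δ, fun p hp hp₀ hp₁ => ?_⟩
    have := hball (a := Complex.exp (toC p)) ⟨by
      rw [mem_ball_zero_iff, norm_exp_toC]
      exact (Real.lt_log_iff_exp_lt hδ).1 hp, exp_toC_mem_upperHalf hp₀ hp₁⟩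
    rw [mem_preimage, logPolar_exp ⟨hp₀.le, hp₁.le⟩, mem_closedBall_iff_norm] at this
    exact this
  have hu : ∀ ε > 0, ∃ X, ∀ p : ℝ × ℝ, p.1 < X → 0 < p.2 → p.2 < Real.pi →
      |D.logAbs p - Real.log ‖α‖| ≤ ε := fun ε hε => by
    obtain ⟨X, hX⟩ := hclose ε hε
    refine ⟨X, fun p hp hp₀ hp₁ => le_trans ?_ (hX p hp hp₀ hp₁)⟩
    have := Complex.abs_re_le_norm (D.logW p - γ)
    rwa [Complex.sub_re, hγre] at this
  have hv : ∀ ε > 0, ∃ X, ∀ p ∈ R, p.1 < X → |D.argSum p - γ.im| ≤ ε := fun ε hε => by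
    obtain ⟨X, hX⟩ := hclose ε hε
    refine ⟨X, fun p hp hpX => ?_⟩
    have hC : IsClosed {w : ℝ | |w - γ.im| ≤ ε} := isClosed_le (by fun_prop) continuous_const
    refine h.mem_of_box h.cont_v hC hpX (fun q hq => ?_) hp ⟨le_rfl, hpX.le⟩
    have := Complex.abs_im_le_norm (D.logW q - γ)
    rw [Complex.sub_im] at this
    exact this.trans (hX q hq.1.2 hq.2.1 hq.2.2)
  have hleft := h.exists_levelSet_left hu
  -- Level points arbitrarily far to the left have arguments close to `γ.im`, and the argument is
  -- monotone along the level set.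
  have hge : ∀ p ∈ levelSet R D.logAbs (Real.log ‖α‖), γ.im ≤ D.argSum p := by
    intro p hp
    refine le_of_forall_pos_le_add fun ε hε => ?_
    obtain ⟨X, hX⟩ := hv ε hε
    obtain ⟨q, hq, hqX⟩ := hleft (min X p.1)
    have h1 := h.v_le_of_levelSet hq hp (hqX.trans_le (min_le_right _ _))
    have h2 := (abs_le.1 (hX q hq.1 (hqX.trans_le (min_le_left _ _)))).1
    linarith
  -- Two further level points to the left of `z₂` let `v_lt_of_three` give strict growth, so the
  -- exceptional case cannot arise here.
  obtain ⟨q, hq, hqx⟩ := hleft (logPolar z₂).1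
  obtain ⟨q', hq', hqx'⟩ := hleft q.1
  refine ⟨γ.im, ?_, (hge q' hq').trans_lt (h.v_lt_of_three hq' hq hp₂ hqx' hqx), fun θ hl => ?_,
    fun c hc hc' => ?_⟩
  · rw [← hγre, Complex.re_add_im, hγα]
  · obtain ⟨γ', hγ₁, hγ₂⟩ := LogIncrement.exists_tendsto h hl
    have := nhdsWithin_upperHalf_neBot (z := 0) le_rfl
    have := nhdsWithin_upperHalf_neBot him₂
    have e₁ := tendsto_nhds_unique hγ₁ hγ
    have e₂ := tendsto_nhds_unique hγ₂ (tendsto_logW h h2 hp₂.1)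
    have e₃ := congrArg Complex.im e₂
    rw [e₁] at e₃
    simp [logW] at e₃
    linarith
  -- A level point so far to the left that its argument is still below `c` serves as the starting
  -- point.
  · obtain ⟨X, hX⟩ := hv ((c - γ.im) / 2) (by linarith)
    obtain ⟨p, hp, hpX⟩ := hleft (min X (logPolar z₂).1)
    have h3 := (abs_le.1 (hX p hp.1 (hpX.trans_le (min_le_left _ _)))).2
    obtain ⟨r, hr, _, hr₂, hrv⟩ := h.exists_levelSet_v_eq hp hp₂ (hpX.trans_le (min_le_right _ _))
      (c := c) (by linarith) hc'
    exact ⟨r, hr, hr₂, hrv⟩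

end WData

theorem mainTheorem4 (D : WData)
    (hW : ∃ z ∈ upperHalf, D.W z ≠ Complex.exp D.C * z ^ (D.B : ℂ))
    (α : ℂ) (hα : α ≠ 0) (z₁ z₂ : ℂ) (hz : ‖z₁‖ < ‖z₂‖)
    (θ : ℝ) (hθ : 0 < θ) (hθ' : θ ≤ 2 * Real.pi ∨ D.LogIncrement z₁ z₂ θ)
    (h₁ : D.TakesValue z₁ α)
    (h₂ : D.TakesValue z₂ (α * Complex.exp ((θ : ℂ) * Complex.I)))
    (hexc : ¬ ((∃ n : ℤ, θ = 2 * Real.pi * n) ∧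
      (z₁.im = 0 ∧ z₂.im = 0 ∧ 0 < z₁.re * z₂.re) ∧
      ∀ z ∈ halfAnnulus z₁ z₂, ∀ w : ℂ, D.TakesValue z w → ‖w‖ ≠ ‖α‖)) :
    ∀ ϱ ∈ Set.Ioo 0 θ, ∃ z ∈ halfAnnulus z₁ z₂,
      D.TakesValue z (α * Complex.exp ((ϱ : ℂ) * Complex.I)) := by
  obtain ⟨R, h⟩ := D.exists_stripPair hW
  have hz₂ : z₂ ≠ 0 := norm_pos_iff.1 ((norm_nonneg _).trans_lt hz)
  have hα₂ : α * Complex.exp ((θ : ℂ) * Complex.I) ≠ 0 := mul_ne_zero hα (Complex.exp_ne_zero _)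
  have hnorm : ‖α * Complex.exp ((θ : ℂ) * Complex.I)‖ = ‖α‖ := by
    rw [norm_mul, Complex.norm_exp_ofReal_mul_I, mul_one]
  obtain ⟨him₂, -, he₂⟩ := WData.mem_of_takesValue h hz₂ hα₂ h₂
  have hp₂ := WData.mem_levelSet_of_takesValue h hz₂ hα₂ h₂
  rw [hnorm] at hp₂
  obtain ⟨v₁, hv₁, hle, hlog, heq, hivt⟩ : ∃ v₁ : ℝ,
      Complex.exp (Real.log ‖α‖ + v₁ * Complex.I) = α ∧ v₁ ≤ D.argSum (logPolar z₂) ∧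
      (∀ θ : ℝ, D.LogIncrement z₁ z₂ θ → D.argSum (logPolar z₂) - v₁ = θ) ∧
      (v₁ = D.argSum (logPolar z₂) → (z₁.im = 0 ∧ z₂.im = 0 ∧ 0 < z₁.re * z₂.re) ∧
        ∀ z ∈ halfAnnulus z₁ z₂, ∀ w : ℂ, D.TakesValue z w → ‖w‖ ≠ ‖α‖) ∧
      ∀ c, v₁ < c → c < D.argSum (logPolar z₂) → ∃ r ∈ levelSet R D.logAbs (Real.log ‖α‖),
        ‖z₁‖ < Real.exp r.1 ∧ r.1 < (logPolar z₂).1 ∧ D.argSum r = c := by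
    by_cases h0 : z₁ = 0
    · subst h0
      rw [norm_zero] at hz
      obtain ⟨v₁, a, b, c, d⟩ := WData.exists_start_zero h hα hz h₁ him₂ hp₂
      refine ⟨v₁, a, b.le, c, fun e => absurd e b.ne, fun t ht ht' => ?_⟩
      obtain ⟨r, hr, hr', e⟩ := d t ht ht'
      exact ⟨r, hr, by rw [norm_zero]; exact Real.exp_pos _, hr', e⟩
    · exact WData.exists_start_of_ne_zero h hα h0 hz h₁ him₂ hp₂
  have hge : θ ≤ D.argSum (logPolar z₂) - v₁ := by
    rcases hθ' with hθ' | hθ'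
    · have hpi := Real.pi_pos
      rw [WData.exp_logW_of_mem hp₂, ← hv₁, ← Complex.exp_add] at he₂
      obtain ⟨k, hk⟩ := Complex.exp_eq_exp_iff_exists_int.1 he₂
      have hk' : D.argSum (logPolar z₂) = v₁ + θ + k * (2 * Real.pi) := by
        have := congrArg Complex.im hk
        simpa using this
      by_contra! hlt
      -- The growth of the argument is `θ + 2πk`. If it is less than `θ` then `k ≤ -1`; being
      -- nonnegative while `θ ≤ 2π`, it must vanish, with `θ = 2π`. This is the excluded case.
      have hk0 : k ≤ -1 := by
        by_contra! hk0
        have : (0 : ℝ) ≤ k := by exact_mod_cast (by omega : 0 ≤ k)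
        have : 0 ≤ (k : ℝ) * (2 * Real.pi) := by positivity
        linarith
      have hk1 : (k : ℝ) ≤ -1 := by exact_mod_cast hk0
      have hk2 : (k : ℝ) * (2 * Real.pi) ≤ -1 * (2 * Real.pi) :=
        mul_le_mul_of_nonneg_right hk1 (by positivity)
      exact hexc ⟨⟨1, by push_cast; linarith⟩, heq (by linarith)⟩
    · exact (hlog θ hθ').ge
  intro ϱ hϱ
  obtain ⟨r, hr, hr₁, hr₂, hrv⟩ := hivt (v₁ + ϱ) (by linarith [hϱ.1]) (by linarith [hϱ.2])
  refine ⟨Complex.exp (toC r), ⟨Complex.exp_im_nonneg ⟨h.snd_nonneg r hr.1, h.snd_le r hr.1⟩,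
    by rwa [norm_exp_toC], ?_⟩, ?_⟩
  · rw [norm_exp_toC, ← Real.exp_log (norm_pos_iff.2 hz₂)]
    exact Real.exp_lt_exp.2 hr₂
  · have := WData.takesValue_of_mem h hr.1
    rw [WData.exp_logW_of_mem hr, hrv] at this
    convert this using 1
    nth_rewrite 1 [← hv₁]
    rw [← Complex.exp_add]
    congr 1
    push_cast; ring
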